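/- Let $n\ge 1$ and let $\sigma$ be the surface measure on the unit sphere $S^{n-1}\subset\mathbb R^n$. For $f\in L^1(\mathbb R^n)$ (complex valued), $\lambda>0$ and $x\in\mathbb R^n$ put $$ f*\varphi_\lambda(x)=(2\pi)^{-n/2}\int_{S^{n-1}}\hat f(\lambda\omega)\,e^{i\lambda x\cdot\omega}\,d\sigma(\omega),\qquad \hat f(\xi)=\int_{\mathbb R^n}f(y)\,e^{-iy\cdot\xi}\,dy. $$ Let $\theta:[0,\infty)\to(0,\infty)$ be a decreasing (not necessarily strictly) function with $\theta(t)\to 0$ as $t\to\infty$ and $\int_1^\infty \theta(t)\,t^{-1}\,dt=\infty$. Let $f\in L^1(\mathbb R^n)$ be nontrivial (not almost everywhere zero) and suppose that $f$ vanishes almost everywhere on a nonempty open set $V\subset\mathbb R^n$. Then there is no constant $C$ such that $$ \sup_{x\in V}|f*\varphi_\lambda(x)|\le C e^{-\lambda\theta(\lambda)}\quad\text{for all }\lambda>0. $$ If moreover $V$ contains a neighbourhood of the origin (that is, $0\in V$), then there is also no constant $C$ such that $$ \sup_{x\in V^c}|f*\varphi_\lambda(x)|\le C e^{-\lambda\theta(\lambda)}\quad\text{for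 all }\lambda>0. $$ -/

import Mathlib

namespace EuclideanProjection

/-- The Fourier transform `f̂(ξ) = ∫ f(y) e^{-i y·ξ} dy` on `ℝⁿ`. -/
noncomputable def fourierHat {n : ℕ} (f : EuclideanSpace ℝ (Fin n) → ℂ)
    (ξ : EuclideanSpace ℝ (Fin n)) : ℂ :=
  ∫ y, f y * Complex.exp (-(Complex.I * ((inner ℝ y ξ : ℝ) : ℂ)))

/-- The surface measure `σ` on the unit sphere `S^{n-1}` of `ℝⁿ`. -/
noncomputable def surfaceMeasure (n : ℕ) :
    MeasureTheory.Measure (Metric.sphere (0 : EuclideanSpace ℝ (Fin n)) 1) :=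
  (MeasureTheory.volume : MeasureTheory.Measure (EuclideanSpace ℝ (Fin n))).toSphere

/-- The generalized spectral projection of the Laplacian of `ℝⁿ`,
`(f ∗ φ_l)(x) = (2π)^{-n/2} ∫_{S^{n-1}} f̂(l ω) e^{i l x·ω} dσ(ω)`. -/
noncomputable def spectralProjection {n : ℕ} (f : EuclideanSpace ℝ (Fin n) → ℂ)
    (l : ℝ) (x : EuclideanSpace ℝ (Fin n)) : ℂ :=
  (((2 * Real.pi) ^ (-(n : ℝ) / 2) : ℝ) : ℂ) *
    ∫ ω : Metric.sphere (0 : EuclideanSpace ℝ (Fin n)) 1,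
      fourierHat f (l • (ω : EuclideanSpace ℝ (Fin n))) *
        Complex.exp (Complex.I * ((l * inner ℝ x (ω : EuclideanSpace ℝ (Fin n)) : ℝ) : ℂ))
      ∂(surfaceMeasure n)

end EuclideanProjection

/-! Fast decay in `l` is quasianalyticity on the Fourier side. Pair the projections with a test
function `φ` supported in a small ball inside `V`, and put `Q ξ = fourierHat f ξ * fourierHat φ
(-ξ)`. The transform of `Q` at `y` is a multiple of `∫ f z * φ (z + y)`, so it vanishes for small
`y`. Up to a constant, the integral of `Q` over the sphere of radius `l` is `∫ φ *
spectralProjection f l`, which inherits the bound `exp (-(l * θ l))`.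

Spherical averaging of `Q` gives a radial function whose transform still vanishes near the origin.
If its moments grow like a Denjoy–Carleman sequence, the transform is quasianalytic on every line
through the origin, hence zero, and so are the spherical integrals (`sphericalIntegral_eq_zero`).
Divergence of the integral of `θ t / t` is exactly the non-summability required.

The weight `exp (-(l * θ l))` alone need not give such moments, since `θ` can drop abruptly. It is
therefore multiplied by `damping ε`, the transform of a measure supported in a ball of radius `4ε`.
This decays like `exp (-c√|ξ|)`, shrinks the vanishing ball by only `4ε`, and is positive for `|ξ| <
1/(4ε)`. Since `ε` may depend on `l`, every radius is reached.

Hence each projection vanishes on a ball. By analyticity (`spectralProjection_eq_zero_of_isOpen`) it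
vanishes everywhere, and polar integration together with Fourier inversion gives `f = 0`. Decay on
`Vᶜ` reduces to this case: pairing with `conj f` controls the L² norm of `fourierHat f` on spheres,
at the price of replacing `θ` by `θ / 2`. -/

open MeasureTheory Filter Topology Finset
open scoped FourierTransform SchwartzMap Pointwise

namespace EuclideanProjection

/-! ### The Denjoy–Carleman theorem by Bang's method. -/

section Quasianalytic

variable {G : ℕ → ℝ → ℂ} {μ : ℕ → ℝ} {C : ℝ}

/-- One step of Bang's argument: the derivatives of a function with a flat jet at `x` stay
small on a short interval to the right of `x`. -/
theorem bang_step (hG : ∀ m s, HasDerivAt (G m) (G (m + 1) s) s) (hμ : ∀ k, 0 < μ k)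
    (hmono : Monotone μ) (hC : 0 ≤ C) (hb : ∀ m s, ‖G m s‖ ≤ C * ∏ k ∈ range m, μ k)
    (N : ℕ) (x : ℝ)
    (hx : ∀ n ≤ N + 1,
      ‖G n x‖ ≤ Real.exp ((n : ℝ) - ((N + 1 : ℕ) : ℝ)) * (C * ∏ k ∈ range n, μ k))
    (t : ℝ) (ht : 0 ≤ t) (htN : t ≤ 1 / (Real.exp 1 * μ N)) :
    ∀ n ≤ N, ‖G n (x + t)‖ ≤ Real.exp ((n : ℝ) - (N : ℝ)) * (C * ∏ k ∈ range n, μ k) := by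
  -- Downward induction on the order `n`. The top order uses only the global bound; each lower order
  -- integrates the estimate above it, with `μ n ≤ μ N` giving a common rate. At distance `1 / (e μ
  -- N)` the exponential costs a single factor `e`.
  have key : ∀ p n, n + p = N + 1 → ∀ y, x ≤ y → ‖G n y‖ ≤
      Real.exp ((n : ℝ) - ((N + 1 : ℕ) : ℝ)) * (C * ∏ k ∈ range n, μ k) *
        Real.exp (Real.exp 1 * μ N * (y - x)) := by
    intro p
    induction p with
    | zero =>
      intro n hn y hy
      obtain rfl : n = N + 1 := by omega
      refine (hb _ _).trans ?_
      have h0 : 0 ≤ C * ∏ k ∈ range (N + 1), μ k :=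
        mul_nonneg hC (prod_nonneg fun k _ => (hμ k).le)
      rw [sub_self, Real.exp_zero, one_mul]
      refine le_mul_of_one_le_right h0 (Real.one_le_exp ?_)
      have := hμ N
      have := sub_nonneg.2 hy
      positivity
    | succ p ih =>
      intro n hn y hy
      have h0 : 0 ≤ C * ∏ k ∈ range n, μ k :=
        mul_nonneg hC (prod_nonneg fun k _ => (hμ k).le)
      set A := Real.exp ((n : ℝ) - ((N + 1 : ℕ) : ℝ)) * (C * ∏ k ∈ range n, μ k) with hA
      refine image_norm_le_of_norm_deriv_right_le_deriv_boundary (f := G n) (f' := G (n + 1))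
        (a := x) (b := y) (B := fun y => A * Real.exp (Real.exp 1 * μ N * (y - x)))
        (B' := fun y => A * (Real.exp (Real.exp 1 * μ N * (y - x)) * (Real.exp 1 * μ N)))
        (fun z _ => (hG n z).continuousAt.continuousWithinAt)
        (fun z _ => (hG n z).hasDerivWithinAt) ?_ ?_ ?_ ⟨hy, le_rfl⟩
      · have := hx n (by omega)
        rw [← hA] at this
        simpa using this
      · intro z
        refine HasDerivAt.const_mul _ (HasDerivAt.exp ?_)
        simpa using ((hasDerivAt_id z).sub_const x).const_mul (Real.exp 1 * μ N)
      · intro z hz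
        refine (ih (n + 1) (by omega) z hz.1).trans ?_
        have e1 : Real.exp (((n + 1 : ℕ) : ℝ) - ((N + 1 : ℕ) : ℝ)) =
            Real.exp ((n : ℝ) - ((N + 1 : ℕ) : ℝ)) * Real.exp 1 := by
          rw [← Real.exp_add]; congr 1; push_cast; ring
        rw [e1, prod_range_succ, hA]
        have hle : μ n ≤ μ N := hmono (by omega)
        have h1 : 0 ≤ Real.exp ((n : ℝ) - ((N + 1 : ℕ) : ℝ)) * (C * ∏ k ∈ range n, μ k) *
          Real.exp 1 * Real.exp (Real.exp 1 * μ N * (z - x)) := by positivity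
        nlinarith [mul_le_mul_of_nonneg_left hle h1]
  intro n hn
  refine (key (N + 1 - n) n (by omega) (x + t) (by linarith)).trans ?_
  have h0 : 0 ≤ C * ∏ k ∈ range n, μ k := mul_nonneg hC (prod_nonneg fun k _ => (hμ k).le)
  have h2 : Real.exp 1 * μ N * (x + t - x) ≤ 1 := by
    have : 0 < Real.exp 1 * μ N := mul_pos (Real.exp_pos _) (hμ N)
    rw [le_div_iff₀ this] at htN
    linarith
  calc _ ≤ Real.exp ((n : ℝ) - ((N + 1 : ℕ) : ℝ)) * (C * ∏ k ∈ range n, μ k) * Real.exp 1 := by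
        gcongr
    _ = Real.exp ((n : ℝ) - (N : ℝ)) * (C * ∏ k ∈ range n, μ k) := by
        rw [mul_right_comm, ← Real.exp_add]; congr 2; push_cast; ring

/-- Each step of `bang_step` trades one level of flatness for a length `1 / (e μ)`. Descending from
level `k + j` to level `k` covers the sum of these lengths. -/
theorem bang_iterate (hG : ∀ m s, HasDerivAt (G m) (G (m + 1) s) s) (hμ : ∀ k, 0 < μ k)
    (hmono : Monotone μ) (hC : 0 ≤ C) (hb : ∀ m s, ‖G m s‖ ≤ C * ∏ k ∈ range m, μ k)
    (j : ℕ) : ∀ (k : ℕ) (x : ℝ),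
    (∀ n ≤ k + j, ‖G n x‖ ≤ Real.exp ((n : ℝ) - ((k + j : ℕ) : ℝ)) * (C * ∏ k ∈ range n, μ k)) →
    ∀ t, 0 ≤ t → t ≤ ∑ i ∈ range j, 1 / (Real.exp 1 * μ (k + i)) →
    ∀ n ≤ k, ‖G n (x + t)‖ ≤ Real.exp ((n : ℝ) - (k : ℝ)) * (C * ∏ k ∈ range n, μ k) := by
  induction j with
  | zero =>
    intro k x hx t ht ht' n hn
    obtain rfl : t = 0 := le_antisymm (by simpa using ht') ht
    simpa using hx n hn
  | succ j ih =>
    intro k x hx t ht ht' n hn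
    rw [sum_range_succ] at ht'
    have hpos : 0 ≤ 1 / (Real.exp 1 * μ (k + j)) := by have := hμ (k + j); positivity
    set t₁ := min t (1 / (Real.exp 1 * μ (k + j))) with ht₁
    have h1 := bang_step hG hμ hmono hC hb (k + j) x hx t₁ (le_min ht hpos) (min_le_right _ _)
    have h2 := ih k (x + t₁) h1 (t - t₁) (sub_nonneg.2 (min_le_left _ _)) ?_ n hn
    · simpa [add_assoc] using h2
    · rcases min_choice t (1 / (Real.exp 1 * μ (k + j))) with h | h
      · rw [ht₁, h, sub_self]
        exact sum_nonneg fun i _ => by have := hμ (k + i); positivity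
      · rw [ht₁, h]; linarith

/-- The Denjoy–Carleman theorem. -/
theorem eq_zero_of_flat_of_not_summable (hG : ∀ m s, HasDerivAt (G m) (G (m + 1) s) s)
    (hμ : ∀ k, 0 < μ k) (hmono : Monotone μ) (hb : ∀ m s, ‖G m s‖ ≤ C * ∏ k ∈ range m, μ k)
    (h0 : ∀ m, G m 0 = 0) (hdiv : ¬ Summable fun k => 1 / μ k) (s : ℝ) (hs : 0 ≤ s) :
    G 0 s = 0 := by
  have hC : 0 ≤ C := by simpa using (norm_nonneg _).trans (hb 0 0)
  have hk : ∀ k : ℕ, ‖G 0 s‖ ≤ Real.exp (-(k : ℝ)) * C := by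
    intro k
    have hdiv' : ¬ Summable fun i => 1 / (Real.exp 1 * μ (k + i)) := by
      intro h
      apply hdiv
      have h' := (summable_nat_add_iff (f := fun i => 1 / μ i) k).1
      apply h'
      have := h.mul_left (Real.exp 1)
      refine this.congr fun i => ?_
      rw [add_comm k i]
      field_simp
    have htend := (not_summable_iff_tendsto_nat_atTop_of_nonneg
      (fun i => by have := hμ (k + i); positivity)).1 hdiv'
    obtain ⟨j, hj⟩ := (htend.eventually_ge_atTop s).exists
    -- All derivatives vanish at `0`, so the starting level is arbitrary. Divergence lets the
    -- descent reach `s` while still ending at level `k`.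
    have := bang_iterate hG hμ hmono hC hb j k 0 (fun n _ => by
      rw [h0, norm_zero]
      have : 0 ≤ ∏ k ∈ range n, μ k := prod_nonneg fun k _ => (hμ k).le
      positivity) s hs hj 0 (Nat.zero_le _)
    simpa using this
  have hlim : Tendsto (fun k : ℕ => Real.exp (-(k : ℝ)) * C) atTop (𝓝 0) := by
    have := (Real.tendsto_exp_neg_atTop_nhds_zero.comp tendsto_natCast_atTop_atTop).mul_const C
    simpa using this
  exact norm_le_zero_iff.1 (ge_of_tendsto' hlim hk)

end Quasianalytic

/-! ### From the weight `θ` to a Denjoy–Carleman sequence. -/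

section Weight

variable {θ : ℝ → ℝ}

/-- The measure `dt / t` is invariant under `t = s ^ 4` up to a constant, so sampling `θ` at fourth
powers preserves divergence. The fourth power is what makes the low factors in
`exists_pow_mul_exp_le` affordable. -/
theorem not_summable_of_lintegral_eq_top (hθpos : ∀ t : ℝ, 0 ≤ t → 0 < θ t)
    (hθanti : AntitoneOn θ (Set.Ici 0))
    (hθint : ∫⁻ t in Set.Ioi (1 : ℝ), ENNReal.ofReal (θ t / t) = ⊤) :
    ¬ Summable fun k : ℕ => θ (((k : ℝ) + 1) ^ 4) / ((k : ℝ) + 1) := by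
  intro hsum
  have hcover : Set.Ioi (1 : ℝ) ⊆ ⋃ k : ℕ, Set.Ioc (((k : ℝ) + 1) ^ 4) (((k : ℝ) + 2) ^ 4) := by
    intro t ht
    have hex : ∃ k : ℕ, t ≤ ((k : ℝ) + 2) ^ 4 := by
      obtain ⟨k, hk⟩ := exists_nat_ge t
      refine ⟨k, hk.trans ?_⟩
      have h : (1 : ℝ) ≤ (k : ℝ) + 2 := by have := k.cast_nonneg (α := ℝ); linarith
      have := le_self_pow₀ h (n := 4) (by norm_num)
      linarith
    classical
    refine Set.mem_iUnion.2 ⟨Nat.find hex, ?_, Nat.find_spec hex⟩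
    rcases h : Nat.find hex with _ | k
    · simpa using ht
    · have := Nat.find_min hex (m := k) (by omega)
      push Not at this
      push_cast
      convert this using 2
      ring
  have hterm : ∀ k : ℕ,
      ∫⁻ t in Set.Ioc (((k : ℝ) + 1) ^ 4) (((k : ℝ) + 2) ^ 4), ENNReal.ofReal (θ t / t) ≤
        ENNReal.ofReal (15 * (θ (((k : ℝ) + 1) ^ 4) / ((k : ℝ) + 1))) := by
    intro k
    have hk : (1 : ℝ) ≤ (k : ℝ) + 1 := by have := k.cast_nonneg (α := ℝ); linarith
    set a : ℝ := (k : ℝ) + 1 with ha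
    have ha2 : (k : ℝ) + 2 = a + 1 := by rw [ha]; ring
    rw [ha2]
    have hθ := hθpos (a ^ 4) (by positivity)
    calc ∫⁻ t in Set.Ioc (a ^ 4) ((a + 1) ^ 4), ENNReal.ofReal (θ t / t)
        ≤ ∫⁻ t in Set.Ioc (a ^ 4) ((a + 1) ^ 4), ENNReal.ofReal (θ (a ^ 4) / a ^ 4) := by
          refine setLIntegral_mono measurable_const fun t ht => ENNReal.ofReal_le_ofReal ?_
          have h4 : 0 < a ^ 4 := by positivity
          have h5 : θ t ≤ θ (a ^ 4) := hθanti h4.le (h4.trans ht.1).le ht.1.le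
          exact div_le_div₀ hθ.le h5 h4 ht.1.le
      _ = ENNReal.ofReal (θ (a ^ 4) / a ^ 4 * ((a + 1) ^ 4 - a ^ 4)) := by
          rw [setLIntegral_const, Real.volume_Ioc, ← ENNReal.ofReal_mul (by positivity)]
      _ ≤ _ := by
          refine ENNReal.ofReal_le_ofReal ?_
          -- `15 = 4 + 6 + 4 + 1`, the lower powers being absorbed since `1 ≤ a`.
          have h6 : (a + 1) ^ 4 - a ^ 4 ≤ 15 * a ^ 3 := by
            nlinarith [mul_nonneg (sub_nonneg.2 hk) (sq_nonneg a),
              mul_nonneg (sub_nonneg.2 hk) (by positivity : 0 ≤ a)]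
          calc _ ≤ θ (a ^ 4) / a ^ 4 * (15 * a ^ 3) := by gcongr
            _ = _ := by field_simp
  have : ∫⁻ t in Set.Ioi (1 : ℝ), ENNReal.ofReal (θ t / t) < ⊤ := by
    calc _ ≤ ∫⁻ t in ⋃ k : ℕ, Set.Ioc (((k : ℝ) + 1) ^ 4) (((k : ℝ) + 2) ^ 4),
          ENNReal.ofReal (θ t / t) := lintegral_mono_set hcover
      _ ≤ ∑' k : ℕ, ∫⁻ t in Set.Ioc (((k : ℝ) + 1) ^ 4) (((k : ℝ) + 2) ^ 4),
          ENNReal.ofReal (θ t / t) := lintegral_iUnion_le _ _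
      _ ≤ ∑' k : ℕ, ENNReal.ofReal (15 * (θ (((k : ℝ) + 1) ^ 4) / ((k : ℝ) + 1))) :=
          ENNReal.tsum_le_tsum hterm
      _ < ⊤ := (hsum.mul_left 15).tsum_ofReal_lt_top
  exact this.ne hθint

/-- The logarithm lies below a line of arbitrarily small slope; the remaining linear term is
absorbed by completing the square. -/
theorem exists_mul_log_le {a c : ℝ} (ha : 0 < a) (hc : 0 < c) :
    ∃ K, ∀ y, 0 ≤ y → y * (4 * Real.log (1 + a * y)) ≤ c * y ^ 2 + K := by
  set δ := c / (8 * a) with hδ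
  have hδ0 : 0 < δ := by positivity
  set L := 4 * |δ - 1 - Real.log δ| with hL
  refine ⟨L ^ 2 / (2 * c), fun y hy => ?_⟩
  have h1 : 0 < 1 + a * y := by positivity
  have h2 : Real.log (1 + a * y) ≤ δ * (a * y) + (δ - 1 - Real.log δ) := by
    have := Real.log_le_sub_one_of_pos (mul_pos hδ0 h1)
    rw [Real.log_mul hδ0.ne' h1.ne'] at this
    linarith
  have h3 : 4 * Real.log (1 + a * y) ≤ c / 2 * y + L := by
    have e : δ * (a * y) = c / 8 * y := by rw [hδ]; field_simp
    have := le_abs_self (δ - 1 - Real.log δ)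
    rw [e] at h2
    rw [hL]; linarith
  have h4 := mul_le_mul_of_nonneg_left h3 hy
  have h5 : y * L ≤ c / 2 * y ^ 2 + L ^ 2 / (2 * c) := by
    have : 0 ≤ (c * y - L) ^ 2 / (2 * c) := by positivity
    have e : (c * y - L) ^ 2 / (2 * c) = c / 2 * y ^ 2 + L ^ 2 / (2 * c) - y * L := by
      field_simp; ring
    linarith
  nlinarith

/-- The weight `exp (-(l θ(l)))`, helped by a stretched exponential, is dominated by a sequence of
Denjoy–Carleman type. -/
theorem exists_pow_mul_exp_le (hθpos : ∀ t : ℝ, 0 ≤ t → 0 < θ t)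
    (hθanti : AntitoneOn θ (Set.Ici 0)) {c : ℝ} (hc : 0 < c) :
    ∃ A, 0 ≤ A ∧ ∀ (m : ℕ) (l : ℝ), 0 ≤ l →
      l ^ m * (Real.exp (-(l * θ l)) * Real.exp (-(c * √l))) ≤
        A * ∏ k ∈ range m, ((k : ℝ) + 1) / θ (((k : ℝ) + 1) ^ 4) := by
  have hθ0 : 0 < θ 0 := hθpos 0 le_rfl
  obtain ⟨K, hK⟩ := exists_mul_log_le (a := 1 + θ 0) (by positivity) hc
  refine ⟨Real.exp K, (Real.exp_pos _).le, fun m l hl => ?_⟩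
  have hθl := hθpos l hl
  set y := √√l with hy
  have hy0 : 0 ≤ y := Real.sqrt_nonneg _
  have hy2 : y ^ 2 = √l := Real.sq_sqrt (Real.sqrt_nonneg _)
  have hy4 : y ^ 4 = l := by
    rw [show y ^ 4 = (y ^ 2) ^ 2 by ring, hy2, Real.sq_sqrt hl]
  -- With `y` the fourth root of `l`, the product of the ratios `r k` splits at `j`. The first `j`
  -- factors are bounded crudely by `(1 + l * θ 0) ^ j`, which is `exp (O(y log y))` and so absorbed
  -- by `exp (c * √l)`. For later factors `(k + 1) ^ 4 ≥ l`, so `θ` is at most `θ l` and they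
  -- multiply to at most `(l * θ l) ^ p / p! ≤ exp (l * θ l)`.
  set j := ⌊y⌋₊ with hj
  set r : ℕ → ℝ := fun k => l * θ (((k : ℝ) + 1) ^ 4) / ((k : ℝ) + 1) with hr
  have hθk : ∀ k : ℕ, 0 < θ (((k : ℝ) + 1) ^ 4) := fun k => hθpos _ (by positivity)
  have hr0 : ∀ k, 0 ≤ r k := fun k => by have := hθk k; positivity
  have hb1 : ∀ k, r k ≤ 1 + l * θ 0 := by
    intro k
    have h1 : θ (((k : ℝ) + 1) ^ 4) ≤ θ 0 :=
      hθanti Set.self_mem_Ici (Set.mem_Ici.2 (by positivity)) (by positivity)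
    calc r k ≤ l * θ (((k : ℝ) + 1) ^ 4) := div_le_self (by have := hθk k; positivity)
          (by have := k.cast_nonneg (α := ℝ); linarith)
      _ ≤ l * θ 0 := by gcongr
      _ ≤ _ := by linarith
  have hone : 1 ≤ 1 + l * θ 0 := by have : 0 ≤ l * θ 0 := by positivity
                                    linarith
  have hlow : ∀ m ≤ j, ∏ k ∈ range m, r k ≤ (1 + l * θ 0) ^ j := by
    intro m hm
    calc ∏ k ∈ range m, r k ≤ ∏ k ∈ range m, (1 + l * θ 0) :=
          prod_le_prod (fun k _ => hr0 k) fun k _ => hb1 k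
      _ = (1 + l * θ 0) ^ m := by simp
      _ ≤ _ := pow_le_pow_right₀ hone hm
  have hhigh : ∀ p, ∏ k ∈ range (j + p), r k ≤
      (1 + l * θ 0) ^ j * ((l * θ l) ^ p / (p.factorial : ℝ)) := by
    intro p
    induction p with
    | zero => simpa using hlow j le_rfl
    | succ p ih =>
      rw [← add_assoc, prod_range_succ]
      have h2 : r (j + p) ≤ l * θ l / ((p : ℝ) + 1) := by
        have hlt : y < (j : ℝ) + 1 := Nat.lt_floor_add_one y
        have hle : l ≤ (((j + p : ℕ) : ℝ) + 1) ^ 4 := by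
          rw [← hy4]
          refine pow_le_pow_left₀ hy0 ?_ 4
          push_cast
          have := p.cast_nonneg (α := ℝ)
          linarith
        have h3 : θ ((((j + p : ℕ) : ℝ) + 1) ^ 4) ≤ θ l := hθanti hl (Set.mem_Ici.2 (by positivity)) hle
        simp only [hr]
        refine div_le_div₀ (by positivity) (by gcongr) (by positivity) ?_
        push_cast
        have := j.cast_nonneg (α := ℝ)
        linarith
      calc _ ≤ (1 + l * θ 0) ^ j * ((l * θ l) ^ p / (p.factorial : ℝ)) * (l * θ l / ((p : ℝ) + 1)) :=
            mul_le_mul ih h2 (hr0 _) (by positivity)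
        _ = _ := by
            rw [Nat.factorial_succ, pow_succ]
            push_cast
            field_simp
  have hexp : (1 + l * θ 0) ^ j ≤ Real.exp K * Real.exp (c * √l) := by
    have h1 : 1 + l * θ 0 ≤ (1 + (1 + θ 0) * y) ^ 4 := by
      rw [← hy4]
      have h2 : y ^ 4 * θ 0 ≤ ((1 + θ 0) * y) ^ 4 := by
        rw [mul_pow, mul_comm]
        gcongr
        have := le_self_pow₀ (show (1 : ℝ) ≤ 1 + θ 0 by linarith) (n := 4) (by norm_num)
        linarith
      have h3 : 0 ≤ (1 + θ 0) * y := by positivity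
      set z := (1 + θ 0) * y
      nlinarith [pow_nonneg h3 2, pow_nonneg h3 3]
    have hz : 0 < 1 + (1 + θ 0) * y := by positivity
    calc (1 + l * θ 0) ^ j ≤ ((1 + (1 + θ 0) * y) ^ 4) ^ j :=
          pow_le_pow_left₀ (by linarith) h1 _
      _ = Real.exp (j * (4 * Real.log (1 + (1 + θ 0) * y))) := by
          rw [Real.exp_nat_mul, show (4 : ℝ) = ((4 : ℕ) : ℝ) by norm_num, Real.exp_nat_mul,
            Real.exp_log hz]
      _ ≤ Real.exp (y * (4 * Real.log (1 + (1 + θ 0) * y))) := by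
          refine Real.exp_le_exp.2 (mul_le_mul_of_nonneg_right (Nat.floor_le hy0) ?_)
          have : 0 ≤ Real.log (1 + (1 + θ 0) * y) := Real.log_nonneg (by
            have : 0 ≤ (1 + θ 0) * y := by positivity
            linarith)
          positivity
      _ ≤ Real.exp (c * y ^ 2 + K) := Real.exp_le_exp.2 (hK y hy0)
      _ = _ := by rw [hy2, Real.exp_add, mul_comm]
  have hall : ∏ k ∈ range m, r k ≤ Real.exp K * Real.exp (c * √l) * Real.exp (l * θ l) := by
    rcases le_total m j with h | h
    · refine ((hlow m h).trans hexp).trans (le_mul_of_one_le_right (by positivity) ?_)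
      exact Real.one_le_exp (by positivity)
    · obtain ⟨p, rfl⟩ := Nat.exists_eq_add_of_le h
      refine (hhigh p).trans (mul_le_mul hexp ?_ (by positivity) (by positivity))
      exact Real.pow_div_factorial_le_exp _ (by positivity) p
  have hprod : ∏ k ∈ range m, r k =
      l ^ m / ∏ k ∈ range m, ((k : ℝ) + 1) / θ (((k : ℝ) + 1) ^ 4) := by
    rw [← card_range m, ← prod_const, card_range, ← prod_div_distrib]
    refine prod_congr rfl fun k _ => ?_
    have := (hθk k).ne'
    simp only [hr]
    field_simp
  have hpos : 0 < ∏ k ∈ range m, ((k : ℝ) + 1) / θ (((k : ℝ) + 1) ^ 4) :=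
    prod_pos fun k _ => by have := hθk k; positivity
  rw [hprod, div_le_iff₀ hpos] at hall
  calc l ^ m * (Real.exp (-(l * θ l)) * Real.exp (-(c * √l)))
      ≤ (Real.exp K * Real.exp (c * √l) * Real.exp (l * θ l) *
          ∏ k ∈ range m, ((k : ℝ) + 1) / θ (((k : ℝ) + 1) ^ 4)) *
          (Real.exp (-(l * θ l)) * Real.exp (-(c * √l))) := by gcongr
    _ = _ := by
        rw [Real.exp_neg, Real.exp_neg]
        field_simp

end Weight

/-! ### Plane waves. -/

section PlaneWave

variable {E : Type*} [NormedAddCommGroup E] [InnerProductSpace ℝ E]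

/-- The plane wave `e^{-i x·ξ}`. -/
noncomputable def planeWave (x ξ : E) : ℂ :=
  Complex.exp (-(Complex.I * ((inner ℝ x ξ : ℝ) : ℂ)))

theorem planeWave_comm (x ξ : E) : planeWave x ξ = planeWave ξ x := by
  rw [planeWave, planeWave, real_inner_comm]

theorem norm_planeWave (x ξ : E) : ‖planeWave x ξ‖ = 1 := by
  rw [planeWave, Complex.norm_exp]; simp

theorem planeWave_add (x y ξ : E) : planeWave (x + y) ξ = planeWave x ξ * planeWave y ξ := by
  rw [planeWave, planeWave, planeWave, ← Complex.exp_add, inner_add_left]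
  congr 1; push_cast; ring

theorem planeWave_smul (s : ℝ) (x ξ : E) : planeWave (s • x) ξ = planeWave x (s • ξ) := by
  rw [planeWave, planeWave, real_inner_smul_left, real_inner_smul_right]

theorem planeWave_neg (x ξ : E) : planeWave (-x) ξ = starRingEnd ℂ (planeWave x ξ) := by
  rw [planeWave, planeWave, ← Complex.exp_conj]
  simp

theorem planeWave_neg_right (x ξ : E) : planeWave x (-ξ) = starRingEnd ℂ (planeWave x ξ) := by
  rw [planeWave_comm, planeWave_neg, planeWave_comm]

theorem planeWave_zero (x : E) : planeWave x 0 = 1 := by simp [planeWave]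

theorem norm_planeWave_sub_one_le (x ξ : E) : ‖planeWave x ξ - 1‖ ≤ ‖x‖ * ‖ξ‖ := by
  have h := Real.norm_exp_I_mul_ofReal_sub_one_le (x := -(inner ℝ x ξ : ℝ))
  have e : planeWave x ξ = Complex.exp (Complex.I * ((-(inner ℝ x ξ : ℝ) : ℝ) : ℂ)) := by
    rw [planeWave]; congr 1; push_cast; ring
  rw [e]
  refine h.trans ?_
  rw [norm_neg]
  exact norm_inner_le_norm x ξ

theorem continuous_planeWave : Continuous fun p : E × E => planeWave p.1 p.2 := by
  unfold planeWave
  fun_prop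

@[fun_prop]
theorem _root_.Continuous.planeWave {X : Type*} [TopologicalSpace X] {f g : X → E}
    (hf : Continuous f) (hg : Continuous g) : Continuous fun x => planeWave (f x) (g x) :=
  continuous_planeWave.comp (hf.prodMk hg)

end PlaneWave

variable {n : ℕ}

/-! ### The Fourier transform, inversion and pairing with test functions. -/

section Fourier

variable {f : EuclideanSpace ℝ (Fin n) → ℂ}

theorem fourierHat_eq (f : EuclideanSpace ℝ (Fin n) → ℂ) (ξ : EuclideanSpace ℝ (Fin n)) :
    fourierHat f ξ = ∫ y, f y * planeWave y ξ := rfl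

theorem norm_fourierHat_le (f : EuclideanSpace ℝ (Fin n) → ℂ) (ξ : EuclideanSpace ℝ (Fin n)) :
    ‖fourierHat f ξ‖ ≤ ∫ y, ‖f y‖ := by
  rw [fourierHat_eq]
  refine (norm_integral_le_integral_norm _).trans_eq ?_
  simp [norm_planeWave]

theorem integrable_mul_planeWave {α : Type*} [MeasurableSpace α] {μ : Measure α} {g : α → ℂ}
    {E : Type*} [NormedAddCommGroup E] [InnerProductSpace ℝ E] {u v : α → E}
    (hg : Integrable g μ) (h : AEStronglyMeasurable (fun a => planeWave (u a) (v a)) μ) :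
    Integrable (fun a => g a * planeWave (u a) (v a)) μ :=
  hg.mul_bdd (c := 1) h (Eventually.of_forall fun _ => (norm_planeWave _ _).le)

theorem continuous_fourierHat (hf : Integrable f) : Continuous (fourierHat f) := by
  have : fourierHat f = fun ξ => ∫ y, f y * planeWave y ξ := rfl
  rw [this]
  refine continuous_of_dominated (bound := fun y => ‖f y‖) (fun ξ => ?_) (fun ξ => ?_) hf.norm ?_
  · exact hf.1.mul (Continuous.aestronglyMeasurable (by fun_prop))
  · exact Eventually.of_forall fun y => by simp [norm_planeWave]
  · exact Eventually.of_forall fun y => by fun_prop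

theorem fourierHat_eq_fourier (f : EuclideanSpace ℝ (Fin n) → ℂ)
    (ξ : EuclideanSpace ℝ (Fin n)) : fourierHat f ξ = 𝓕 f ((2 * Real.pi)⁻¹ • ξ) := by
  rw [Real.fourier_eq', fourierHat_eq]
  congr 1
  ext y
  rw [smul_eq_mul, mul_comm, planeWave, real_inner_smul_right]
  congr 2
  have : (Real.pi : ℂ) ≠ 0 := by exact_mod_cast Real.pi_ne_zero
  push_cast
  field_simp

theorem integrable_fourierHat_neg (φ : 𝓢(EuclideanSpace ℝ (Fin n), ℂ)) :
    Integrable fun ξ => fourierHat φ (-ξ) := by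
  have h : (fun ξ => fourierHat φ (-ξ)) = fun ξ => (𝓕 φ) ((-(2 * Real.pi)⁻¹) • ξ) := by
    ext ξ
    rw [fourierHat_eq_fourier, SchwartzMap.fourier_coe, smul_neg, neg_smul]
  rw [h]
  exact (SchwartzMap.integrable (𝓕 φ)).comp_smul (by simp)

/-- Only the nonvanishing of the constant matters later, so its value stays hidden. -/
theorem exists_fourier_inversion (n : ℕ) : ∃ c : ℂ, c ≠ 0 ∧
    ∀ (φ : 𝓢(EuclideanSpace ℝ (Fin n), ℂ)) (z : EuclideanSpace ℝ (Fin n)),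
      ∫ ξ, fourierHat φ (-ξ) * planeWave z ξ = c * φ z := by
  have hpi := Real.pi_ne_zero
  refine ⟨((|((-(2 * Real.pi)⁻¹) ^ n)⁻¹| : ℝ) : ℂ), ?_, fun φ z => ?_⟩
  · rw [Complex.ofReal_ne_zero, abs_ne_zero]
    exact inv_ne_zero (pow_ne_zero _ (by simp))
  · have h : ∀ ξ, fourierHat φ (-ξ) * planeWave z ξ =
        (fun η => Complex.exp (((2 * Real.pi * inner ℝ η z : ℝ) : ℂ) * Complex.I) • (𝓕 φ) η)
          ((-(2 * Real.pi)⁻¹) • ξ) := by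
      intro ξ
      beta_reduce
      rw [fourierHat_eq_fourier, SchwartzMap.fourier_coe, smul_neg, ← neg_smul, smul_eq_mul, mul_comm,
        planeWave, real_inner_smul_left, real_inner_comm]
      congr 2
      have : (Real.pi : ℂ) ≠ 0 := by exact_mod_cast Real.pi_ne_zero
      push_cast
      field_simp
    refine (integral_congr_ae (Eventually.of_forall h)).trans ?_
    refine (Measure.integral_comp_smul volume (fun η =>
      Complex.exp (((2 * Real.pi * inner ℝ η z : ℝ) : ℂ) * Complex.I) • (𝓕 φ) η)
      (-(2 * Real.pi)⁻¹)).trans ?_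
    rw [finrank_euclideanSpace_fin, Complex.real_smul]
    congr 1
    have h2 : 𝓕⁻ (𝓕 φ) z = φ z := by rw [FourierTransform.fourierInv_fourier_eq]
    rw [SchwartzMap.fourierInv_coe, Real.fourierInv_eq'] at h2
    exact h2

/-- The pairing of `f` with a translate of `φ`, on the Fourier side. -/
theorem integral_fourierHat_mul (hf : Integrable f) (φ : 𝓢(EuclideanSpace ℝ (Fin n), ℂ)) {c : ℂ}
    (hc : ∀ z, ∫ ξ, fourierHat φ (-ξ) * planeWave z ξ = c * φ z)
    (y : EuclideanSpace ℝ (Fin n)) :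
    ∫ ξ, fourierHat f ξ * fourierHat φ (-ξ) * planeWave y ξ = c * ∫ z, f z * φ (z + y) := by
  have h1 : ∀ ξ, fourierHat f ξ * fourierHat φ (-ξ) * planeWave y ξ =
      ∫ z, f z * (fourierHat φ (-ξ) * planeWave (z + y) ξ) := by
    intro ξ
    rw [fourierHat_eq f, mul_assoc, ← integral_mul_const]
    congr 1; ext z; rw [planeWave_add]; ring
  simp_rw [h1]
  rw [integral_integral_swap, ← integral_const_mul]
  · congr 1; ext z
    rw [integral_const_mul, hc]; ring
  · have h2 := (integrable_fourierHat_neg φ).mul_prod hf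
    have h3 := integrable_mul_planeWave (u := fun p : EuclideanSpace ℝ (Fin n) × EuclideanSpace ℝ (Fin n) => p.2 + y)
      (v := fun p => p.1) h2 (Continuous.aestronglyMeasurable (by fun_prop))
    refine h3.congr (Eventually.of_forall fun p => ?_)
    simp only [Function.uncurry]; ring

end Fourier

/-! ### Polar coordinates. -/

section Polar

theorem surfaceMeasure_eq (n : ℕ) : surfaceMeasure n =
    (volume : Measure (EuclideanSpace ℝ (Fin n))).toSphere := rfl

instance (n : ℕ) : IsFiniteMeasure (surfaceMeasure n) := by
  rw [surfaceMeasure_eq]; infer_instance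

theorem integral_polar (hn : 1 ≤ n) (h : EuclideanSpace ℝ (Fin n) → ℂ) :
    ∫ ξ, h ξ = ∫ p : Metric.sphere (0 : EuclideanSpace ℝ (Fin n)) 1 × Set.Ioi (0 : ℝ),
      h (p.2.1 • p.1.1) ∂((surfaceMeasure n).prod (Measure.volumeIoiPow (n - 1))) := by
  have : Nonempty (Fin n) := ⟨⟨0, hn⟩⟩
  have hmp := (volume : Measure (EuclideanSpace ℝ (Fin n))).measurePreserving_homeomorphUnitSphereProd
  rw [finrank_euclideanSpace_fin, ← surfaceMeasure_eq] at hmp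
  rw [← hmp.integral_comp (Homeomorph.measurableEmbedding _)]
  have : ∀ x : ({(0)}ᶜ : Set (EuclideanSpace ℝ (Fin n))),
      h ((homeomorphUnitSphereProd _ x).2.1 • (homeomorphUnitSphereProd _ x).1.1) = h x.1 := by
    intro x
    have hx : ‖x.1‖ ≠ 0 := norm_ne_zero_iff.2 x.2
    simp [smul_smul, hx]
  simp_rw [this]
  rw [integral_subtype_comap (measurableSet_singleton _).compl h, restrict_compl_singleton]

theorem integrable_polar {h : EuclideanSpace ℝ (Fin n) → ℂ} (hh : Integrable h) :
    Integrable (fun p : Metric.sphere (0 : EuclideanSpace ℝ (Fin n)) 1 × Set.Ioi (0 : ℝ) =>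
      h (p.2.1 • p.1.1)) ((surfaceMeasure n).prod (Measure.volumeIoiPow (n - 1))) := by
  have hmp := (volume : Measure (EuclideanSpace ℝ (Fin n))).measurePreserving_homeomorphUnitSphereProd
  rw [finrank_euclideanSpace_fin, ← surfaceMeasure_eq] at hmp
  rw [← hmp.integrable_comp_emb (Homeomorph.measurableEmbedding _)]
  have : ∀ x : ({(0)}ᶜ : Set (EuclideanSpace ℝ (Fin n))),
      h ((homeomorphUnitSphereProd _ x).2.1 • (homeomorphUnitSphereProd _ x).1.1) = h x.1 := by
    intro x
    have hx : ‖x.1‖ ≠ 0 := norm_ne_zero_iff.2 x.2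
    simp [smul_smul, hx]
  have h2 : IntegrableOn h {(0 : EuclideanSpace ℝ (Fin n))}ᶜ := hh.integrableOn
  rw [integrableOn_iff_comap_subtypeVal (measurableSet_singleton _).compl] at h2
  exact h2.congr (Eventually.of_forall fun x => (this x).symm)

/-- Integrating against a radial factor only sees spherical integrals. -/
theorem integral_radial_mul (hn : 1 ≤ n) {R Q : EuclideanSpace ℝ (Fin n) → ℂ}
    (hR : ∀ ξ η, ‖ξ‖ = ‖η‖ → R ξ = R η) (hRQ : Integrable fun ξ => R ξ * Q ξ) :
    ((surfaceMeasure n).real Set.univ : ℂ) * ∫ ξ, R ξ * Q ξ =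
      ∫ ξ, R ξ * ∫ ω : Metric.sphere (0 : EuclideanSpace ℝ (Fin n)) 1,
        Q (‖ξ‖ • ω.1) ∂(surfaceMeasure n) := by
  set e : EuclideanSpace ℝ (Fin n) := EuclideanSpace.single ⟨0, hn⟩ (1 : ℝ) with he
  have he1 : ‖e‖ = 1 := by simp [he]
  have hRe : ∀ (t : Set.Ioi (0 : ℝ)) (ω : Metric.sphere (0 : EuclideanSpace ℝ (Fin n)) 1),
      R (t.1 • ω.1) = R (t.1 • e) := fun t ω => hR _ _ (by simp [norm_smul, he1])
  have hnorm : ∀ (t : Set.Ioi (0 : ℝ)) (ω : Metric.sphere (0 : EuclideanSpace ℝ (Fin n)) 1),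
      ‖t.1 • ω.1‖ = t.1 := fun t ω => by
        have : 0 < t.1 := t.2
        simp [norm_smul, abs_of_pos this]
  rw [integral_polar hn, integral_polar hn, integral_prod_symm _ (integrable_polar hRQ)]
  simp_rw [hRe, hnorm, integral_const_mul]
  rw [integral_fun_snd (fun t : Set.Ioi (0 : ℝ) => R (t.1 • e) *
    ∫ ω : Metric.sphere (0 : EuclideanSpace ℝ (Fin n)) 1, Q (t.1 • ω.1) ∂(surfaceMeasure n)),
    Complex.real_smul]

end Polar

/-! ### Rotation invariance of the surface measure. -/

section Rotation

/-- The action of a linear isometry on the unit sphere. -/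
noncomputable def sphereMap (L : EuclideanSpace ℝ (Fin n) ≃ₗᵢ[ℝ] EuclideanSpace ℝ (Fin n))
    (ω : Metric.sphere (0 : EuclideanSpace ℝ (Fin n)) 1) :
    Metric.sphere (0 : EuclideanSpace ℝ (Fin n)) 1 :=
  ⟨L ω.1, by simp⟩

theorem continuous_sphereMap (L : EuclideanSpace ℝ (Fin n) ≃ₗᵢ[ℝ] EuclideanSpace ℝ (Fin n)) :
    Continuous (sphereMap L) :=
  (L.continuous.comp continuous_subtype_val).subtype_mk _

/-- The surface measure of a set is `n` times the volume of the cone over it, and isometries map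
cones to cones preserving volume. -/
theorem measurePreserving_sphereMap
    (L : EuclideanSpace ℝ (Fin n) ≃ₗᵢ[ℝ] EuclideanSpace ℝ (Fin n)) :
    MeasurePreserving (sphereMap L) (surfaceMeasure n) (surfaceMeasure n) := by
  have hm := (continuous_sphereMap L).measurable
  refine ⟨hm, Measure.ext fun s hs => ?_⟩
  rw [Measure.map_apply hm hs, surfaceMeasure_eq, Measure.toSphere_apply' _ (hm hs),
    Measure.toSphere_apply' _ hs]
  congr 1
  have hL := L.measurePreserving.measure_preimage_equiv (f := L.toMeasurableEquiv)
    (Set.Ioo (0 : ℝ) 1 • (Subtype.val '' s : Set (EuclideanSpace ℝ (Fin n))))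
  rw [← hL]
  congr 1
  ext x
  simp only [Set.mem_preimage, Set.mem_smul, Set.mem_image]
  constructor
  · rintro ⟨t, ht, _, ⟨ω, hω, rfl⟩, rfl⟩
    exact ⟨t, ht, _, ⟨sphereMap L ω, hω, rfl⟩, (L.map_smul t ω.1).symm⟩
  · rintro ⟨t, ht, _, ⟨ω, hω, rfl⟩, h⟩
    refine ⟨t, ht, _, ⟨sphereMap L.symm ω, ?_, rfl⟩, ?_⟩
    · convert hω
      ext1
      exact L.apply_symm_apply ω.1
    · apply L.injective
      change L (t • L.symm ω.1) = L x
      rw [L.map_smul, L.apply_symm_apply]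
      exact h

/-- The reflection in the hyperplane orthogonal to `ξ - η` swaps the two vectors. -/
theorem exists_isometry_apply_eq {ξ η : EuclideanSpace ℝ (Fin n)} (h : ‖ξ‖ = ‖η‖) :
    ∃ L : EuclideanSpace ℝ (Fin n) ≃ₗᵢ[ℝ] EuclideanSpace ℝ (Fin n), L ξ = η :=
  ⟨_, Submodule.reflection_sub h⟩

theorem planeWave_map (L : EuclideanSpace ℝ (Fin n) ≃ₗᵢ[ℝ] EuclideanSpace ℝ (Fin n))
    (x ξ : EuclideanSpace ℝ (Fin n)) : planeWave (L x) (L ξ) = planeWave x ξ := by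
  rw [planeWave, planeWave, L.inner_map_map]

/-- The Fourier transform of the surface measure. -/
noncomputable def sphereWave (ξ : EuclideanSpace ℝ (Fin n)) : ℂ :=
  ∫ ω : Metric.sphere (0 : EuclideanSpace ℝ (Fin n)) 1, planeWave ω.1 ξ ∂(surfaceMeasure n)

theorem sphereWave_radial {ξ η : EuclideanSpace ℝ (Fin n)} (h : ‖ξ‖ = ‖η‖) :
    sphereWave ξ = sphereWave η := by
  obtain ⟨L, rfl⟩ := exists_isometry_apply_eq h
  have h := integral_map (μ := surfaceMeasure n) (continuous_sphereMap L).aemeasurable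
    (f := fun ω => planeWave ω.1 (L ξ)) (Continuous.aestronglyMeasurable (by fun_prop))
  rw [(measurePreserving_sphereMap L).map_eq] at h
  rw [sphereWave, sphereWave, h]
  exact integral_congr_ae (Eventually.of_forall fun ω => (planeWave_map L ω.1 ξ).symm)

end Rotation

/-! ### Quasianalytic Fourier integrals along a line. -/

section LineTransform

variable {α : Type*} [MeasurableSpace α] {ν : Measure α} {g : α → ℂ} {τ : α → ℝ}

/-- The `m`-th derivative of `s ↦ ∫ g e^{-i s τ}`. -/
noncomputable def lineTransform (ν : Measure α) (g : α → ℂ) (τ : α → ℝ) (m : ℕ) (s : ℝ) : ℂ :=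
  ∫ a, g a * (-(Complex.I * (τ a : ℂ))) ^ m * Complex.exp (-(Complex.I * ((s * τ a : ℝ) : ℂ))) ∂ν

omit [MeasurableSpace α] in
theorem norm_lineTransform_integrand (m : ℕ) (s : ℝ) (a : α) :
    ‖g a * (-(Complex.I * (τ a : ℂ))) ^ m * Complex.exp (-(Complex.I * ((s * τ a : ℝ) : ℂ)))‖ =
      ‖g a‖ * |τ a| ^ m := by
  rw [norm_mul, norm_mul, norm_pow, norm_neg, norm_mul, Complex.norm_I, one_mul,
    Complex.norm_real, Real.norm_eq_abs, Complex.norm_exp]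
  simp

theorem aestronglyMeasurable_lineTransform_integrand (hg : AEStronglyMeasurable g ν)
    (hτ : AEStronglyMeasurable τ ν) (m : ℕ) (s : ℝ) :
    AEStronglyMeasurable (fun a => g a * (-(Complex.I * (τ a : ℂ))) ^ m *
      Complex.exp (-(Complex.I * ((s * τ a : ℝ) : ℂ)))) ν := by
  have h1 : AEStronglyMeasurable (fun a => (-(Complex.I * (τ a : ℂ))) ^ m) ν :=
    (show Continuous fun t : ℝ => (-(Complex.I * (t : ℂ))) ^ m by fun_prop).comp_aestronglyMeasurable hτ
  have h2 : AEStronglyMeasurable (fun a => Complex.exp (-(Complex.I * ((s * τ a : ℝ) : ℂ)))) ν :=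
    (show Continuous fun t : ℝ => Complex.exp (-(Complex.I * ((s * t : ℝ) : ℂ))) by
      fun_prop).comp_aestronglyMeasurable hτ
  exact (hg.mul h1).mul h2

theorem hasDerivAt_lineTransform (hg : AEStronglyMeasurable g ν) (hτ : AEStronglyMeasurable τ ν)
    (hint : ∀ m : ℕ, Integrable (fun a => ‖g a‖ * |τ a| ^ m) ν) (m : ℕ) (s : ℝ) :
    HasDerivAt (lineTransform ν g τ m) (lineTransform ν g τ (m + 1) s) s := by
  refine (hasDerivAt_integral_of_dominated_loc_of_deriv_le (s := Set.univ) (x₀ := s)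
    (F' := fun s a => g a * (-(Complex.I * (τ a : ℂ))) ^ (m + 1) *
      Complex.exp (-(Complex.I * ((s * τ a : ℝ) : ℂ))))
    (bound := fun a => ‖g a‖ * |τ a| ^ (m + 1)) univ_mem
    (Eventually.of_forall fun t => aestronglyMeasurable_lineTransform_integrand hg hτ m t) ?_
    (aestronglyMeasurable_lineTransform_integrand hg hτ (m + 1) s) ?_ (hint (m + 1)) ?_).2
  · exact ((hint m).mono' (aestronglyMeasurable_lineTransform_integrand hg hτ m s)
      (Eventually.of_forall fun a => (norm_lineTransform_integrand m s a).le))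
  · exact Eventually.of_forall fun a t _ => (norm_lineTransform_integrand (m + 1) t a).le
  · refine Eventually.of_forall fun a t _ => ?_
    have h1 : HasDerivAt (fun t : ℝ => -(Complex.I * ((t * τ a : ℝ) : ℂ)))
        (-(Complex.I * (τ a : ℂ))) t := by
      have := ((((hasDerivAt_id' t).mul_const (τ a)).ofReal_comp).const_mul Complex.I).fun_neg
      rwa [one_mul] at this
    have h2 := h1.cexp.const_mul (g a * (-(Complex.I * (τ a : ℂ))) ^ m)
    refine h2.congr_deriv ?_
    ring

/-- Quasianalyticity: a Fourier integral whose density has moments of Denjoy–Carleman type and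
which vanishes near the origin vanishes on the half-line. -/
theorem lineTransform_eq_zero {μ : ℕ → ℝ} {C δ : ℝ}
    (hg : AEStronglyMeasurable g ν) (hτ : AEStronglyMeasurable τ ν)
    (hint : ∀ m : ℕ, Integrable (fun a => ‖g a‖ * |τ a| ^ m) ν)
    (hb : ∀ m, ∫ a, ‖g a‖ * |τ a| ^ m ∂ν ≤ C * ∏ k ∈ range m, μ k)
    (hμ : ∀ k, 0 < μ k) (hmono : Monotone μ) (hdiv : ¬ Summable fun k => 1 / μ k)
    (hδ : 0 < δ) (h0 : ∀ s, |s| < δ → lineTransform ν g τ 0 s = 0) (s : ℝ) (hs : 0 ≤ s) :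
    lineTransform ν g τ 0 s = 0 := by
  have hd := hasDerivAt_lineTransform hg hτ hint
  -- Vanishing on an open interval passes to every derivative, giving the flat jet at `0`.
  have hz : ∀ m s, |s| < δ → lineTransform ν g τ m s = 0 := by
    intro m
    induction m with
    | zero => exact h0
    | succ m ih =>
      intro s hs
      have hev : lineTransform ν g τ m =ᶠ[𝓝 s] fun _ => 0 := by
        filter_upwards [(isOpen_lt continuous_abs continuous_const).mem_nhds hs] with t ht
        exact ih t ht
      exact (hd m s).unique ((hasDerivAt_const s (0 : ℂ)).congr_of_eventuallyEq hev)
  refine eq_zero_of_flat_of_not_summable hd hμ hmono (C := C) (fun m s => ?_)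
    (fun m => hz m 0 (by simpa using hδ)) hdiv s hs
  refine ((norm_integral_le_integral_norm _).trans_eq ?_).trans (hb m)
  simp_rw [norm_lineTransform_integrand]

end LineTransform

/-! ### The Fourier transform of a ball. -/

section Ball

/-- The uniform probability measure on the unit ball. -/
noncomputable def ballMeasure (n : ℕ) : Measure (EuclideanSpace ℝ (Fin n)) :=
  (volume (Metric.ball (0 : EuclideanSpace ℝ (Fin n)) 1))⁻¹ •
    volume.restrict (Metric.ball (0 : EuclideanSpace ℝ (Fin n)) 1)

instance (n : ℕ) : IsProbabilityMeasure (ballMeasure n) := by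
  constructor
  rw [ballMeasure, Measure.smul_apply, Measure.restrict_apply_univ, smul_eq_mul]
  exact ENNReal.inv_mul_cancel (Metric.measure_ball_pos _ _ one_pos).ne' measure_ball_lt_top.ne

theorem ae_ballMeasure (n : ℕ) : ∀ᵐ v ∂(ballMeasure n), ‖v‖ < 1 := by
  refine Measure.ae_smul_measure ?_ _
  filter_upwards [ae_restrict_mem Metric.isOpen_ball.measurableSet] with v hv
  simpa using hv

/-- The Fourier transform of the uniform probability measure on the unit ball. -/
noncomputable def ballWave (ξ : EuclideanSpace ℝ (Fin n)) : ℂ :=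
  ∫ v, planeWave v ξ ∂(ballMeasure n)

theorem ballWave_radial {ξ η : EuclideanSpace ℝ (Fin n)} (h : ‖ξ‖ = ‖η‖) :
    ballWave ξ = ballWave η := by
  obtain ⟨L, rfl⟩ := exists_isometry_apply_eq h
  rw [ballWave, ballWave, ballMeasure, integral_smul_measure, integral_smul_measure]
  congr 1
  have hb : (L : _ → EuclideanSpace ℝ (Fin n)) ⁻¹' Metric.ball 0 1 = Metric.ball 0 1 := by
    ext x; simp
  have := L.measurePreserving.setIntegral_preimage_emb L.toMeasurableEquiv.measurableEmbedding
    (fun v => planeWave v (L ξ)) (Metric.ball 0 1)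
  rw [hb] at this
  rw [← this]
  simp_rw [planeWave_map]

theorem integrable_planeWave_ball (ξ : EuclideanSpace ℝ (Fin n)) :
    Integrable (fun v => planeWave v ξ) (ballMeasure n) :=
  Integrable.of_bound (Continuous.aestronglyMeasurable (by fun_prop)) 1
    (Eventually.of_forall fun v => (norm_planeWave v ξ).le)

theorem norm_ballWave_le (ξ : EuclideanSpace ℝ (Fin n)) : ‖ballWave ξ‖ ≤ 1 := by
  refine (norm_integral_le_integral_norm _).trans ?_
  simp [norm_planeWave]

theorem norm_ballWave_sub_one_le (ξ : EuclideanSpace ℝ (Fin n)) : ‖ballWave ξ - 1‖ ≤ ‖ξ‖ := by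
  have h : ballWave ξ - 1 = ∫ v, (planeWave v ξ - 1) ∂(ballMeasure n) := by
    rw [integral_sub (integrable_planeWave_ball ξ) (integrable_const _)]
    simp [ballWave]
  rw [h]
  refine (norm_integral_le_of_norm_le_const (C := ‖ξ‖) ?_).trans_eq (by simp)
  filter_upwards [ae_ballMeasure n] with v hv
  refine (norm_planeWave_sub_one_le v ξ).trans ?_
  exact mul_le_of_le_one_left (norm_nonneg _) hv.le

theorem continuous_ballWave : Continuous (ballWave (n := n)) := by
  unfold ballWave
  refine continuous_of_dominated (bound := fun _ => 1) (fun ξ => ?_) (fun ξ => ?_)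
    (integrable_const _) ?_
  · exact Continuous.aestronglyMeasurable (by fun_prop)
  · exact Eventually.of_forall fun y => (norm_planeWave _ _).le
  · exact Eventually.of_forall fun y => by fun_prop

theorem ballWave_neg (ξ : EuclideanSpace ℝ (Fin n)) :
    ballWave (-ξ) = starRingEnd ℂ (ballWave ξ) := by
  rw [ballWave, ballWave, ← integral_conj]
  simp_rw [planeWave_neg_right]

theorem ballWave_eq_fourierHat (ξ : EuclideanSpace ℝ (Fin n)) :
    ballWave ξ = (volume (Metric.ball (0 : EuclideanSpace ℝ (Fin n)) 1))⁻¹.toReal •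
      fourierHat ((Metric.ball (0 : EuclideanSpace ℝ (Fin n)) 1).indicator 1) ξ := by
  rw [ballWave, ballMeasure, integral_smul_measure, fourierHat_eq,
    ← integral_indicator Metric.isOpen_ball.measurableSet]
  congr 2
  ext v
  by_cases hv : v ∈ Metric.ball (0 : EuclideanSpace ℝ (Fin n)) 1 <;> simp [hv]

/-- The Riemann–Lebesgue lemma for the unit ball. -/
theorem exists_norm_ballWave_sq_le (n : ℕ) : ∃ R : ℝ, 0 < R ∧
    ∀ ξ : EuclideanSpace ℝ (Fin n), R ≤ ‖ξ‖ → ‖ballWave ξ‖ ^ 2 ≤ Real.exp (-1) := by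
  have h1 : Tendsto (𝓕 ((Metric.ball (0 : EuclideanSpace ℝ (Fin n)) 1).indicator (1 : EuclideanSpace ℝ (Fin n) → ℂ)))
      (cocompact _) (𝓝 0) := tendsto_integral_exp_inner_smul_cocompact _
  have h2 : Tendsto (ballWave (n := n)) (cocompact _) (𝓝 0) := by
    have hs : Tendsto (fun ξ : EuclideanSpace ℝ (Fin n) => (2 * Real.pi)⁻¹ • ξ)
        (cocompact _) (cocompact _) :=
      (Homeomorph.smulOfNeZero ((2 * Real.pi)⁻¹) (by simp [Real.pi_ne_zero])).isClosedEmbedding.tendsto_cocompact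
    have := (h1.comp hs).const_smul
      (volume (Metric.ball (0 : EuclideanSpace ℝ (Fin n)) 1))⁻¹.toReal
    rw [smul_zero] at this
    refine this.congr fun ξ => ?_
    rw [ballWave_eq_fourierHat, fourierHat_eq_fourier, Function.comp_apply]
  have h3 : ∀ᶠ ξ in cocompact (EuclideanSpace ℝ (Fin n)), ‖ballWave ξ‖ ^ 2 ≤ Real.exp (-1) := by
    have := (h2.norm.pow 2)
    rw [norm_zero, zero_pow two_ne_zero] at this
    exact this.eventually_le_const (Real.exp_pos _)
  rw [← Metric.cobounded_eq_cocompact, ← comap_norm_atTop, eventually_comap] at h3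
  obtain ⟨R, hR⟩ := eventually_atTop.1 h3
  exact ⟨max R 1, by positivity, fun ξ hξ => hR ‖ξ‖ ((le_max_left _ _).trans hξ) ξ rfl⟩

end Ball

/-! ### A compactly supported measure with stretched-exponential Fourier decay. -/

section Damping

/-- The Fourier transform of an iterated convolution of uniform measures on small balls. -/
noncomputable def partialDamping (ε : ℝ) (K : ℕ) (ξ : EuclideanSpace ℝ (Fin n)) : ℝ :=
  ∏ k ∈ range K, ‖ballWave ((ε / ((k : ℝ) + 1) ^ 2) • ξ)‖ ^ 2

theorem partialDamping_nonneg (ε : ℝ) (K : ℕ) (ξ : EuclideanSpace ℝ (Fin n)) :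
    0 ≤ partialDamping ε K ξ := prod_nonneg fun _ _ => by positivity

theorem norm_ballWave_sq_le_one (ξ : EuclideanSpace ℝ (Fin n)) : ‖ballWave ξ‖ ^ 2 ≤ 1 :=
  pow_le_one₀ (norm_nonneg _) (norm_ballWave_le _)

theorem partialDamping_le_one (ε : ℝ) (K : ℕ) (ξ : EuclideanSpace ℝ (Fin n)) :
    partialDamping ε K ξ ≤ 1 :=
  prod_le_one (fun _ _ => by positivity) fun _ _ => norm_ballWave_sq_le_one _

theorem antitone_partialDamping (ε : ℝ) (ξ : EuclideanSpace ℝ (Fin n)) :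
    Antitone fun K => partialDamping ε K ξ := by
  refine antitone_nat_of_succ_le fun K => ?_
  rw [partialDamping, prod_range_succ]
  exact mul_le_of_le_one_right (partialDamping_nonneg ε K ξ) (norm_ballWave_sq_le_one _)

theorem continuous_partialDamping (ε : ℝ) (K : ℕ) :
    Continuous (partialDamping (n := n) ε K) := by
  unfold partialDamping
  have := continuous_ballWave (n := n)
  fun_prop

/-- The Fourier transform of an infinite convolution of uniform measures on balls. -/
noncomputable def damping (ε : ℝ) (ξ : EuclideanSpace ℝ (Fin n)) : ℝ :=
  ⨅ K, partialDamping ε K ξ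

theorem bddBelow_partialDamping (ε : ℝ) (ξ : EuclideanSpace ℝ (Fin n)) :
    BddBelow (Set.range fun K => partialDamping ε K ξ) :=
  ⟨0, by rintro _ ⟨K, rfl⟩; exact partialDamping_nonneg ε K ξ⟩

theorem tendsto_partialDamping (ε : ℝ) (ξ : EuclideanSpace ℝ (Fin n)) :
    Tendsto (fun K => partialDamping ε K ξ) atTop (𝓝 (damping ε ξ)) :=
  tendsto_atTop_ciInf (antitone_partialDamping ε ξ) (bddBelow_partialDamping ε ξ)

theorem damping_le_partialDamping (ε : ℝ) (K : ℕ) (ξ : EuclideanSpace ℝ (Fin n)) :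
    damping ε ξ ≤ partialDamping ε K ξ := ciInf_le (bddBelow_partialDamping ε ξ) K

theorem damping_nonneg (ε : ℝ) (ξ : EuclideanSpace ℝ (Fin n)) : 0 ≤ damping ε ξ :=
  le_ciInf fun K => partialDamping_nonneg ε K ξ

theorem damping_le_one (ε : ℝ) (ξ : EuclideanSpace ℝ (Fin n)) : damping ε ξ ≤ 1 :=
  (damping_le_partialDamping ε 0 ξ).trans (partialDamping_le_one ε 0 ξ)

theorem damping_radial (ε : ℝ) {ξ η : EuclideanSpace ℝ (Fin n)} (h : ‖ξ‖ = ‖η‖) :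
    damping ε ξ = damping ε η := by
  unfold damping partialDamping
  congr 1; ext K
  refine prod_congr rfl fun k _ => ?_
  rw [ballWave_radial (η := (ε / ((k : ℝ) + 1) ^ 2) • η) (by rw [norm_smul, norm_smul, h])]

theorem measurable_damping (ε : ℝ) : Measurable (damping (n := n) ε) :=
  measurable_of_tendsto_metrizable (fun K => (continuous_partialDamping ε K).measurable)
    (tendsto_pi_nhds.2 fun ξ => tendsto_partialDamping ε ξ)

/-- By Riemann–Lebesgue, a factor is at most `1 / e` once its rescaled frequency has norm at least
`R`. This holds for all `k` with `(k + 1) ^ 2 ≤ ε |ξ| / R`, about `√(ε |ξ| / R)` factors. The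
leading `e` pays for the floor. -/
theorem exists_damping_le (n : ℕ) {ε : ℝ} (hε : 0 < ε) : ∃ c : ℝ, 0 < c ∧
    ∀ ξ : EuclideanSpace ℝ (Fin n), damping ε ξ ≤ Real.exp 1 * Real.exp (-(c * √‖ξ‖)) := by
  obtain ⟨R, hR, hball⟩ := exists_norm_ballWave_sq_le n
  refine ⟨√(ε / R), Real.sqrt_pos.2 (by positivity), fun ξ => ?_⟩
  set x := √(ε / R) * √‖ξ‖ with hx
  have hx0 : 0 ≤ x := by positivity
  have hx2 : x ^ 2 = ε / R * ‖ξ‖ := by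
    rw [hx, mul_pow, Real.sq_sqrt (by positivity), Real.sq_sqrt (norm_nonneg _)]
  have h1 : partialDamping ε ⌊x⌋₊ ξ ≤ ∏ k ∈ range ⌊x⌋₊, Real.exp (-1) := by
    refine prod_le_prod (fun _ _ => by positivity) fun k hk => hball _ ?_
    have hkx : (k : ℝ) + 1 ≤ x := by
      have := Nat.floor_le hx0
      have h2 : ((k + 1 : ℕ) : ℝ) ≤ ⌊x⌋₊ := Nat.cast_le.2 (mem_range.1 hk)
      push_cast at h2
      linarith
    have hk2 : ((k : ℝ) + 1) ^ 2 ≤ ε / R * ‖ξ‖ := hx2 ▸ pow_le_pow_left₀ (by positivity) hkx 2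
    rw [norm_smul, Real.norm_of_nonneg (by positivity), div_mul_eq_mul_div, le_div_iff₀ (by positivity)]
    calc R * ((k : ℝ) + 1) ^ 2 ≤ R * (ε / R * ‖ξ‖) := by gcongr
      _ = ε * ‖ξ‖ := by field_simp
  refine (damping_le_partialDamping ε _ ξ).trans (h1.trans ?_)
  rw [prod_const, card_range, ← Real.exp_nat_mul, ← Real.exp_add]
  refine Real.exp_le_exp.2 ?_
  have := Nat.lt_floor_add_one x
  linarith

theorem sum_inv_sq_le (K : ℕ) : ∑ k ∈ range K, 1 / ((k : ℝ) + 1) ^ 2 ≤ 2 - 1 / (K : ℝ) := by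
  induction K with
  | zero => simp
  | succ K ih =>
    rw [sum_range_succ]
    -- Here `1 / 0 = 0`, so the hypothesis for `K = 0` is too weak to telescope and the first term
    -- is checked directly.
    rcases Nat.eq_zero_or_pos K with rfl | hK
    · norm_num
    · have hK' : (0 : ℝ) < K := Nat.cast_pos.2 hK
      have : 1 / ((K : ℝ) + 1) ^ 2 ≤ 1 / (K : ℝ) - 1 / ((K : ℝ) + 1) := by
        rw [div_sub_div _ _ hK'.ne' (by positivity), div_le_div_iff₀ (by positivity) (by positivity)]
        nlinarith
      push_cast
      linarith

theorem sum_radii_le {ε : ℝ} (hε : 0 < ε) (K : ℕ) :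
    ∑ k ∈ range K, 2 * (ε / ((k : ℝ) + 1) ^ 2) ≤ 4 * ε := by
  have h1 : ∑ k ∈ range K, 2 * (ε / ((k : ℝ) + 1) ^ 2) =
      2 * ε * ∑ k ∈ range K, 1 / ((k : ℝ) + 1) ^ 2 := by
    rw [mul_sum]; refine sum_congr rfl fun k _ => by ring
  have h2 : ∑ k ∈ range K, 1 / ((k : ℝ) + 1) ^ 2 ≤ 2 :=
    (sum_inv_sq_le K).trans (by have : 0 ≤ 1 / (K : ℝ) := by positivity
                                linarith)
  rw [h1]
  nlinarith

/-- Each squared factor loses at most twice its radius times `|ξ|`, and the losses add up. This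
gives positivity of the damping on the ball of radius `1 / (4ε)`. -/
theorem le_damping {ε : ℝ} (hε : 0 < ε) (ξ : EuclideanSpace ℝ (Fin n)) :
    1 - 4 * ε * ‖ξ‖ ≤ damping ε ξ := by
  refine le_ciInf fun K => ?_
  have h : 1 - (∑ k ∈ range K, 2 * (ε / ((k : ℝ) + 1) ^ 2)) * ‖ξ‖ ≤ partialDamping ε K ξ := by
    induction K with
    | zero => simp [partialDamping]
    | succ K ih =>
      rw [sum_range_succ, partialDamping, prod_range_succ]
      change _ ≤ partialDamping ε K ξ * _
      set b := ‖ballWave ((ε / ((K : ℝ) + 1) ^ 2) • ξ)‖ with hb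
      have h1 : 1 - ε / ((K : ℝ) + 1) ^ 2 * ‖ξ‖ ≤ b := by
        have h2 := norm_ballWave_sub_one_le ((ε / ((K : ℝ) + 1) ^ 2) • ξ)
        rw [norm_smul, Real.norm_of_nonneg (by positivity)] at h2
        have h3 := norm_sub_norm_le (1 : ℂ) (ballWave ((ε / ((K : ℝ) + 1) ^ 2) • ξ))
        rw [norm_one, norm_sub_rev] at h3
        linarith
      have hb2 : b ^ 2 ≤ 1 := norm_ballWave_sq_le_one _
      have h4 : 1 - b ^ 2 ≤ 2 * (ε / ((K : ℝ) + 1) ^ 2) * ‖ξ‖ := by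
        nlinarith [sq_nonneg (1 - b)]
      have h5 := partialDamping_le_one ε K ξ
      nlinarith [mul_nonneg (sub_nonneg.2 h5) (sub_nonneg.2 hb2)]
  have := mul_le_mul_of_nonneg_right (sum_radii_le hε K) (norm_nonneg ξ)
  linarith

variable {Q : EuclideanSpace ℝ (Fin n) → ℂ}

/-- Multiplication by `ballWave (a • ξ)` averages the transform over a ball of radius `|a|`, which
shrinks the region of vanishing by `|a|`. -/
theorem integral_mul_ballWave_eq_zero (hQ : Integrable Q) {r : ℝ}
    (h0 : ∀ y : EuclideanSpace ℝ (Fin n), ‖y‖ < r → ∫ ξ, Q ξ * planeWave y ξ = 0) (a : ℝ)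
    (y : EuclideanSpace ℝ (Fin n)) (hy : ‖y‖ < r - |a|) :
    ∫ ξ, Q ξ * ballWave (a • ξ) * planeWave y ξ = 0 := by
  have h1 : ∀ ξ, Q ξ * ballWave (a • ξ) * planeWave y ξ =
      ∫ v, Q ξ * planeWave (y + a • v) ξ ∂(ballMeasure n) := by
    intro ξ
    rw [integral_const_mul, ballWave, mul_assoc, ← integral_mul_const]
    congr 2; ext v
    rw [planeWave_add, planeWave_smul, mul_comm]
  simp_rw [h1]
  rw [integral_integral_swap]
  · refine integral_eq_zero_of_ae ?_
    filter_upwards [ae_ballMeasure n] with v hv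
    refine h0 _ ((norm_add_le _ _).trans_lt ?_)
    rw [norm_smul, Real.norm_eq_abs]
    have : |a| * ‖v‖ ≤ |a| := mul_le_of_le_one_right (abs_nonneg _) hv.le
    linarith
  · exact integrable_mul_planeWave (u := fun p : EuclideanSpace ℝ (Fin n) × EuclideanSpace ℝ (Fin n) => y + a • p.2)
      (v := fun p => p.1) (hQ.comp_fst (ν := ballMeasure n)) (Continuous.aestronglyMeasurable (by fun_prop))

theorem integrable_mul_ballWave (hQ : Integrable Q) (a : ℝ) :
    Integrable fun ξ => Q ξ * ballWave (a • ξ) :=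
  hQ.mul_bdd (c := 1) (continuous_ballWave.comp (continuous_const_smul a)).aestronglyMeasurable
    (Eventually.of_forall fun _ => norm_ballWave_le _)

theorem integral_mul_partialDamping_eq_zero (hQ : Integrable Q) {r ε : ℝ} (hε : 0 < ε)
    (h0 : ∀ y : EuclideanSpace ℝ (Fin n), ‖y‖ < r → ∫ ξ, Q ξ * planeWave y ξ = 0) (K : ℕ) :
    Integrable (fun ξ => Q ξ * (partialDamping ε K ξ : ℂ)) ∧
    ∀ y : EuclideanSpace ℝ (Fin n), ‖y‖ < r - ∑ k ∈ range K, 2 * (ε / ((k : ℝ) + 1) ^ 2) →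
      ∫ ξ, Q ξ * (partialDamping ε K ξ : ℂ) * planeWave y ξ = 0 := by
  induction K with
  | zero => simpa [partialDamping] using ⟨hQ, h0⟩
  | succ K ih =>
    set a := ε / ((K : ℝ) + 1) ^ 2 with ha
    have ha0 : |a| = a := abs_of_nonneg (by positivity)
    -- The squared modulus is a product of the waves at `a` and `-a`, so each factor costs two
    -- radii.
    have hstep : ∀ ξ : EuclideanSpace ℝ (Fin n), Q ξ * (partialDamping ε (K + 1) ξ : ℂ) =
        Q ξ * (partialDamping ε K ξ : ℂ) * ballWave (a • ξ) * ballWave ((-a) • ξ) := by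
      intro ξ
      rw [neg_smul, ballWave_neg, mul_assoc _ (ballWave _), Complex.mul_conj,
        Complex.normSq_eq_norm_sq, partialDamping, prod_range_succ, ← partialDamping]
      push_cast
      ring
    simp_rw [hstep]
    have h1 := integrable_mul_ballWave ih.1 a
    refine ⟨integrable_mul_ballWave h1 (-a), fun y hy => ?_⟩
    rw [sum_range_succ] at hy
    refine integral_mul_ballWave_eq_zero h1
      (fun y hy => integral_mul_ballWave_eq_zero ih.1 ih.2 a y hy) (-a) y ?_
    rw [abs_neg, ha0]
    linarith

theorem integral_mul_damping_eq_zero (hQ : Integrable Q) {r ε : ℝ} (hε : 0 < ε)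
    (h0 : ∀ y : EuclideanSpace ℝ (Fin n), ‖y‖ < r + 4 * ε → ∫ ξ, Q ξ * planeWave y ξ = 0)
    (y : EuclideanSpace ℝ (Fin n)) (hy : ‖y‖ < r) :
    ∫ ξ, Q ξ * (damping ε ξ : ℂ) * planeWave y ξ = 0 := by
  have hK := integral_mul_partialDamping_eq_zero hQ hε h0
  have hlim : Tendsto (fun K => ∫ ξ, Q ξ * (partialDamping ε K ξ : ℂ) * planeWave y ξ) atTop
      (𝓝 (∫ ξ, Q ξ * (damping ε ξ : ℂ) * planeWave y ξ)) := by
    refine tendsto_integral_of_dominated_convergence (fun ξ => ‖Q ξ‖) (fun K => ?_) hQ.norm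
      (fun K => Eventually.of_forall fun ξ => ?_) (Eventually.of_forall fun ξ => ?_)
    · exact (hK K).1.1.mul (Continuous.aestronglyMeasurable (by fun_prop))
    · rw [norm_mul, norm_mul, norm_planeWave, mul_one, Complex.norm_real,
        Real.norm_of_nonneg (partialDamping_nonneg _ _ _)]
      exact mul_le_of_le_one_right (norm_nonneg _) (partialDamping_le_one _ _ _)
    · exact ((Complex.continuous_ofReal.tendsto _).comp
        (tendsto_partialDamping ε ξ)).const_mul (Q ξ) |>.mul_const _
  have hz : ∀ K, ∫ ξ, Q ξ * (partialDamping ε K ξ : ℂ) * planeWave y ξ = 0 := fun K =>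
    (hK K).2 y (by have := sum_radii_le hε K; linarith)
  simp_rw [hz] at hlim
  exact tendsto_nhds_unique hlim tendsto_const_nhds

end Damping

/-! ### Testing against Schwartz functions and injectivity of the transform. -/

section TestFunctions

open scoped ContDiff in
theorem exists_schwartzMap_eq {g : EuclideanSpace ℝ (Fin n) → ℝ} (hg : ContDiff ℝ ∞ g)
    (hgs : HasCompactSupport g) :
    ∃ φ : 𝓢(EuclideanSpace ℝ (Fin n), ℂ), ∀ x, φ x = (g x : ℂ) := by
  have h : HasCompactSupport (Complex.ofRealCLM ∘ g) := hgs.comp_left rfl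
  exact ⟨h.toSchwartzMap (Complex.ofRealCLM.contDiff.comp hg), fun x => rfl⟩

theorem ae_eq_zero_of_integral_mul_schwartzMap {f : EuclideanSpace ℝ (Fin n) → ℂ}
    (hf : Integrable f) (h : ∀ φ : 𝓢(EuclideanSpace ℝ (Fin n), ℂ), ∫ x, f x * φ x = 0) :
    f =ᵐ[volume] 0 := by
  refine ae_eq_zero_of_integral_contDiff_smul_eq_zero hf.locallyIntegrable fun g hg hgs => ?_
  obtain ⟨φ, hφ⟩ := exists_schwartzMap_eq hg hgs
  rw [← h φ]
  congr 1; ext x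
  rw [hφ, Complex.real_smul, mul_comm]

theorem ae_eq_zero_of_fourierHat_eq_zero {f : EuclideanSpace ℝ (Fin n) → ℂ} (hf : Integrable f)
    (h : ∀ ξ, fourierHat f ξ = 0) : f =ᵐ[volume] 0 := by
  obtain ⟨c, hc0, hc⟩ := exists_fourier_inversion n
  refine ae_eq_zero_of_integral_mul_schwartzMap hf fun φ => ?_
  have := integral_fourierHat_mul hf φ (hc φ) 0
  simpa [h, hc0] using this.symm

end TestFunctions

/-! ### Vanishing of rapidly decaying spherical integrals. -/

section SphericalIntegral

/-- The integral over the sphere of radius `l`, with respect to the surface measure of the unit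
sphere. -/
noncomputable def sphericalIntegral (Q : EuclideanSpace ℝ (Fin n) → ℂ) (l : ℝ) : ℂ :=
  ∫ ω : Metric.sphere (0 : EuclideanSpace ℝ (Fin n)) 1, Q (l • ω.1) ∂(surfaceMeasure n)

theorem continuous_sphericalIntegral {Q : EuclideanSpace ℝ (Fin n) → ℂ} (hQ : Continuous Q) :
    Continuous (sphericalIntegral Q) := by
  have h := continuous_parametric_integral_of_continuous (μ := surfaceMeasure n)
    (f := fun (l : ℝ) (ω : Metric.sphere (0 : EuclideanSpace ℝ (Fin n)) 1) => Q (l • ω.1))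
    (by unfold Function.uncurry; fun_prop) isCompact_univ
  simp only [Measure.restrict_univ] at h
  exact h

theorem surfaceMeasure_univ_ne_zero (hn : 1 ≤ n) : ((surfaceMeasure n).real Set.univ : ℂ) ≠ 0 := by
  have : Nonempty (Fin n) := ⟨⟨0, hn⟩⟩
  rw [Complex.ofReal_ne_zero, measureReal_def, ENNReal.toReal_ne_zero]
  refine ⟨?_, measure_ne_top _ _⟩
  rw [surfaceMeasure_eq, ne_eq, Measure.measure_univ_eq_zero]
  exact Measure.toSphere_ne_zero _

theorem ae_ne_zero (hn : 1 ≤ n) : ∀ᵐ ξ : EuclideanSpace ℝ (Fin n), ξ ≠ 0 := by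
  have : Nonempty (Fin n) := ⟨⟨0, hn⟩⟩
  exact compl_mem_ae_iff.2 (measure_singleton 0)

theorem integral_eq_zero_of_sphericalIntegral (hn : 1 ≤ n) {Q : EuclideanSpace ℝ (Fin n) → ℂ}
    (hQ : Integrable Q) (h : ∀ l, 0 < l → sphericalIntegral Q l = 0) : ∫ ξ, Q ξ = 0 := by
  have h1 := integral_radial_mul hn (R := fun _ => 1) (Q := Q) (fun _ _ _ => rfl)
    (by simpa using hQ)
  have h2 : ∫ ξ : EuclideanSpace ℝ (Fin n), (1 : ℂ) *
      ∫ ω : Metric.sphere (0 : EuclideanSpace ℝ (Fin n)) 1,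
        Q (‖ξ‖ • ω.1) ∂(surfaceMeasure n) = 0 := by
    refine integral_eq_zero_of_ae ?_
    filter_upwards [ae_ne_zero hn] with ξ hξ
    rw [one_mul]
    exact h ‖ξ‖ (norm_pos_iff.2 hξ)
  rw [h2] at h1
  simpa [surfaceMeasure_univ_ne_zero hn] using h1

theorem integrable_exp_neg_sqrt_norm (hn : 1 ≤ n) {c : ℝ} (hc : 0 < c) :
    Integrable fun ξ : EuclideanSpace ℝ (Fin n) => Real.exp (-(c * √‖ξ‖)) := by
  have : Nonempty (Fin n) := ⟨⟨0, hn⟩⟩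
  rw [integrable_fun_norm_addHaar volume (f := fun t => Real.exp (-(c * √t))), finrank_euclideanSpace_fin]
  refine (integrableOn_rpow_mul_exp_neg_mul_rpow (p := 1 / 2) (s := ((n - 1 : ℕ) : ℝ)) (b := c)
    (by have := (n - 1).cast_nonneg (α := ℝ); linarith) (by norm_num) hc).congr_fun ?_
    measurableSet_Ioi
  intro x _
  simp only [smul_eq_mul]
  rw [Real.rpow_natCast, ← Real.sqrt_eq_rpow, neg_mul]

variable {θ : ℝ → ℝ} {Q : EuclideanSpace ℝ (Fin n) → ℂ}

/-- The product of the damping factor with the spherical integrals of `Q`. -/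
noncomputable def dampedRadial (ε : ℝ) (Q : EuclideanSpace ℝ (Fin n) → ℂ)
    (ξ : EuclideanSpace ℝ (Fin n)) : ℂ :=
  (damping ε ξ : ℂ) * sphericalIntegral Q ‖ξ‖

theorem aestronglyMeasurable_dampedRadial (ε : ℝ) (hQ : Continuous Q) :
    AEStronglyMeasurable (dampedRadial ε Q) volume := by
  refine AEStronglyMeasurable.mul ?_ ?_
  · exact (Complex.measurable_ofReal.comp (measurable_damping ε)).aestronglyMeasurable
  · exact ((continuous_sphericalIntegral hQ).comp continuous_norm).aestronglyMeasurable

/-- The stretched exponential from the damping is split in two: one half feeds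
`exists_pow_mul_exp_le`, the other keeps the integral over space finite. -/
theorem exists_moment_bound (hn : 1 ≤ n) (hθpos : ∀ t : ℝ, 0 ≤ t → 0 < θ t)
    (hθanti : AntitoneOn θ (Set.Ici 0)) (hQc : Continuous Q) {ε C : ℝ} (hε : 0 < ε)
    (hC : ∀ l, 0 < l → ‖sphericalIntegral Q l‖ ≤ C * Real.exp (-(l * θ l))) :
    ∃ B, ∀ m : ℕ, Integrable (fun ξ => ‖dampedRadial ε Q ξ‖ * ‖ξ‖ ^ m) ∧
      ∫ ξ, ‖dampedRadial ε Q ξ‖ * ‖ξ‖ ^ m ≤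
        B * ∏ k ∈ range m, ((k : ℝ) + 1) / θ (((k : ℝ) + 1) ^ 4) := by
  obtain ⟨c, hc, hdamp⟩ := exists_damping_le n hε
  obtain ⟨A, hA, hpow⟩ := exists_pow_mul_exp_le hθpos hθanti (half_pos hc)
  have hC0 : 0 ≤ C := by
    have := (norm_nonneg _).trans (hC 1 one_pos)
    exact nonneg_of_mul_nonneg_left this (Real.exp_pos _)
  have hint := integrable_exp_neg_sqrt_norm hn (half_pos hc)
  set J := ∫ ξ : EuclideanSpace ℝ (Fin n), Real.exp (-(c / 2 * √‖ξ‖)) with hJ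
  refine ⟨Real.exp 1 * C * A * J, fun m => ?_⟩
  set W := ∏ k ∈ range m, ((k : ℝ) + 1) / θ (((k : ℝ) + 1) ^ 4) with hW
  have hbound : ∀ᵐ ξ : EuclideanSpace ℝ (Fin n), ‖dampedRadial ε Q ξ‖ * ‖ξ‖ ^ m ≤
      Real.exp 1 * C * (A * W) * Real.exp (-(c / 2 * √‖ξ‖)) := by
    filter_upwards [ae_ne_zero hn] with ξ hξ
    have h1 := hC ‖ξ‖ (norm_pos_iff.2 hξ)
    have h2 : Real.exp (-(c * √‖ξ‖)) =
        Real.exp (-(c / 2 * √‖ξ‖)) * Real.exp (-(c / 2 * √‖ξ‖)) := by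
      rw [← Real.exp_add]; congr 1; ring
    have h3 := hdamp ξ
    rw [h2] at h3
    rw [dampedRadial, norm_mul, Complex.norm_real, Real.norm_of_nonneg (damping_nonneg ε ξ)]
    calc damping ε ξ * ‖sphericalIntegral Q ‖ξ‖‖ * ‖ξ‖ ^ m
        ≤ (Real.exp 1 * (Real.exp (-(c / 2 * √‖ξ‖)) * Real.exp (-(c / 2 * √‖ξ‖)))) *
          (C * Real.exp (-(‖ξ‖ * θ ‖ξ‖))) * ‖ξ‖ ^ m := by
          gcongr
      _ = Real.exp 1 * C * (‖ξ‖ ^ m * (Real.exp (-(‖ξ‖ * θ ‖ξ‖)) *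
            Real.exp (-(c / 2 * √‖ξ‖)))) * Real.exp (-(c / 2 * √‖ξ‖)) := by ring
      _ ≤ _ := by
          have := hpow m ‖ξ‖ (norm_nonneg _)
          gcongr
  have hmeas : AEStronglyMeasurable (fun ξ => ‖dampedRadial ε Q ξ‖ * ‖ξ‖ ^ m) volume :=
    (aestronglyMeasurable_dampedRadial ε hQc).norm.mul
      (continuous_norm.pow m).aestronglyMeasurable
  have hI : Integrable fun ξ => ‖dampedRadial ε Q ξ‖ * ‖ξ‖ ^ m := by
    refine (hint.const_mul (Real.exp 1 * C * (A * W))).mono' hmeas ?_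
    filter_upwards [hbound] with ξ hξ
    rwa [Real.norm_of_nonneg (by positivity)]
  refine ⟨hI, (integral_mono_ae hI (hint.const_mul _) hbound).trans_eq ?_⟩
  rw [integral_const_mul, ← hJ]
  ring

theorem sphereWave_smul_eq (s : ℝ) {u : EuclideanSpace ℝ (Fin n)} (hu : ‖u‖ = 1)
    (ξ : EuclideanSpace ℝ (Fin n)) :
    sphericalIntegral (fun η => planeWave (s • u) η) ‖ξ‖ = sphereWave (s • ξ) := by
  have h : sphereWave (s • ξ) = sphereWave (‖ξ‖ • (s • u)) :=
    sphereWave_radial (by simp [norm_smul, hu, mul_comm])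
  rw [h, sphereWave, sphericalIntegral]
  congr 1; ext ω
  rw [planeWave_comm, planeWave_smul]

theorem integrable_damping_mul (ε : ℝ) (hQ : Integrable Q) :
    Integrable fun ξ => Q ξ * (damping ε ξ : ℂ) :=
  hQ.mul_bdd (c := 1) (Complex.measurable_ofReal.comp (measurable_damping ε)).aestronglyMeasurable
    (Eventually.of_forall fun ξ => by
      rw [Complex.norm_real, Real.norm_of_nonneg (damping_nonneg ε ξ)]
      exact damping_le_one ε ξ)

/-- The transform of a spherical average is the spherical average of the transform.
`integral_radial_mul` is applied twice, moving the average from the plane wave onto the radial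
kernel `sphereWave` and then onto `Q`; the total mass of the sphere cancels. -/
theorem integral_dampedRadial_mul_planeWave (hn : 1 ≤ n) {ε : ℝ} (hQ : Integrable Q)
    (hq : Integrable (dampedRadial ε Q)) (s : ℝ) {u : EuclideanSpace ℝ (Fin n)} (hu : ‖u‖ = 1) :
    ∫ ξ, dampedRadial ε Q ξ * planeWave (s • u) ξ =
      ∫ ω : Metric.sphere (0 : EuclideanSpace ℝ (Fin n)) 1,
        (∫ ξ, Q ξ * (damping ε ξ : ℂ) * planeWave (s • ω.1) ξ) ∂(surfaceMeasure n) := by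
  have hσ := surfaceMeasure_univ_ne_zero hn
  have hQd := integrable_damping_mul ε hQ
  have hrad : ∀ ξ η : EuclideanSpace ℝ (Fin n), ‖ξ‖ = ‖η‖ →
      dampedRadial ε Q ξ = dampedRadial ε Q η := by
    intro ξ η h
    rw [dampedRadial, dampedRadial, damping_radial ε h, h]
  have h1 := integral_radial_mul hn hrad (Q := fun ξ => planeWave (s • u) ξ)
    (integrable_mul_planeWave hq (Continuous.aestronglyMeasurable (by fun_prop)))
  have hprod : Integrable (fun p : EuclideanSpace ℝ (Fin n) ×
      Metric.sphere (0 : EuclideanSpace ℝ (Fin n)) 1 =>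
      Q p.1 * (damping ε p.1 : ℂ) * planeWave (s • p.2.1) p.1)
      (volume.prod (surfaceMeasure n)) :=
    integrable_mul_planeWave (hQd.comp_fst (ν := surfaceMeasure n))
      (Continuous.aestronglyMeasurable (by fun_prop))
  have hsw : ∀ ξ : EuclideanSpace ℝ (Fin n), (damping ε ξ : ℂ) * sphereWave (s • ξ) * Q ξ =
      ∫ ω : Metric.sphere (0 : EuclideanSpace ℝ (Fin n)) 1,
        Q ξ * (damping ε ξ : ℂ) * planeWave (s • ω.1) ξ ∂(surfaceMeasure n) := by
    intro ξ
    rw [integral_const_mul, sphereWave]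
    simp_rw [planeWave_smul]
    ring
  have h2 := integral_radial_mul hn
    (R := fun ξ : EuclideanSpace ℝ (Fin n) => (damping ε ξ : ℂ) * sphereWave (s • ξ)) (Q := Q)
    (fun ξ η h => by
      beta_reduce
      rw [damping_radial ε h, sphereWave_radial (η := s • η) (by rw [norm_smul, norm_smul, h])])
    (by simp_rw [hsw]; exact hprod.integral_prod_left)
  have h3 : ∀ ξ : EuclideanSpace ℝ (Fin n), dampedRadial ε Q ξ *
      ∫ ω : Metric.sphere (0 : EuclideanSpace ℝ (Fin n)) 1,
        planeWave (s • u) (‖ξ‖ • ω.1) ∂(surfaceMeasure n) =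
      (damping ε ξ : ℂ) * sphereWave (s • ξ) *
      ∫ ω : Metric.sphere (0 : EuclideanSpace ℝ (Fin n)) 1,
        Q (‖ξ‖ • ω.1) ∂(surfaceMeasure n) := by
    intro ξ
    change _ * sphericalIntegral (fun η => planeWave (s • u) η) ‖ξ‖ =
      _ * _ * sphericalIntegral Q ‖ξ‖
    rw [sphereWave_smul_eq s hu, dampedRadial]
    ring
  simp_rw [h3] at h1
  rw [← h2] at h1
  rw [mul_left_cancel₀ hσ h1]
  simp_rw [hsw]
  exact integral_integral_swap hprod

/-- If the Fourier transform of `Q` vanishes near the origin and the spherical integrals of `Q`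
decay fast, then the spherical integrals vanish. -/
theorem sphericalIntegral_eq_zero (hn : 1 ≤ n) (hθpos : ∀ t : ℝ, 0 ≤ t → 0 < θ t)
    (hθanti : AntitoneOn θ (Set.Ici 0))
    (hθint : ∫⁻ t in Set.Ioi (1 : ℝ), ENNReal.ofReal (θ t / t) = ⊤)
    (hQc : Continuous Q) (hQ : Integrable Q) {r ε C : ℝ} (hr : 0 < r) (hε : 0 < ε)
    (h0 : ∀ y : EuclideanSpace ℝ (Fin n), ‖y‖ < r + 4 * ε → ∫ ξ, Q ξ * planeWave y ξ = 0)
    (hC : ∀ l, 0 < l → ‖sphericalIntegral Q l‖ ≤ C * Real.exp (-(l * θ l)))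
    {l : ℝ} (hl : 0 < l) (hlε : 4 * ε * l < 1) : sphericalIntegral Q l = 0 := by
  obtain ⟨B, hB⟩ := exists_moment_bound hn hθpos hθanti hQc hε hC
  have hqm := aestronglyMeasurable_dampedRadial ε hQc
  have hq : Integrable (dampedRadial ε Q) := by
    have := (hB 0).1
    simp only [pow_zero, mul_one] at this
    exact (integrable_norm_iff hqm).1 this
  set μ : ℕ → ℝ := fun k => ((k : ℝ) + 1) / θ (((k : ℝ) + 1) ^ 4) with hμ
  have hμpos : ∀ k, 0 < μ k := fun k => by
    have := hθpos (((k : ℝ) + 1) ^ 4) (by positivity)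
    positivity
  have hμmono : Monotone μ := by
    intro i j hij
    have hij' : (i : ℝ) ≤ j := Nat.cast_le.2 hij
    refine div_le_div₀ (by positivity) (by linarith) (hθpos _ (by positivity)) ?_
    exact hθanti (Set.mem_Ici.2 (by positivity)) (Set.mem_Ici.2 (by positivity)) (by gcongr)
  have hμdiv : ¬ Summable fun k => 1 / μ k := by
    have := not_summable_of_lintegral_eq_top hθpos hθanti hθint
    simpa [hμ] using this
  -- On the ray through `u` the transform is a one-dimensional Fourier integral with `τ = ⟨u, ξ⟩`,
  -- whose moments are dominated by those of `|ξ|`.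
  have hline : ∀ u : EuclideanSpace ℝ (Fin n), ‖u‖ = 1 → ∀ s : ℝ, 0 ≤ s →
      ∫ ξ, dampedRadial ε Q ξ * planeWave (s • u) ξ = 0 := by
    intro u hu s hs
    have hle : ∀ (m : ℕ) (ξ : EuclideanSpace ℝ (Fin n)),
        ‖dampedRadial ε Q ξ‖ * |(inner ℝ u ξ : ℝ)| ^ m ≤ ‖dampedRadial ε Q ξ‖ * ‖ξ‖ ^ m := by
      intro m ξ
      have := abs_real_inner_le_norm u ξ
      rw [hu, one_mul] at this
      gcongr
    have hτ : AEStronglyMeasurable (fun ξ : EuclideanSpace ℝ (Fin n) => (inner ℝ u ξ : ℝ))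
        volume := Continuous.aestronglyMeasurable (by fun_prop)
    have hint : ∀ m : ℕ, Integrable fun ξ : EuclideanSpace ℝ (Fin n) =>
        ‖dampedRadial ε Q ξ‖ * |(inner ℝ u ξ : ℝ)| ^ m := fun m => by
      refine (hB m).1.mono' (hqm.norm.mul ((continuous_abs.comp_aestronglyMeasurable hτ).pow m))
        (Eventually.of_forall fun ξ => ?_)
      rw [Real.norm_of_nonneg (by positivity)]
      exact hle m ξ
    have heq : ∀ s, lineTransform volume (dampedRadial ε Q)
        (fun ξ : EuclideanSpace ℝ (Fin n) => (inner ℝ u ξ : ℝ)) 0 s =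
        ∫ ξ, dampedRadial ε Q ξ * planeWave (s • u) ξ := by
      intro s
      simp only [lineTransform, pow_zero, mul_one, planeWave, real_inner_smul_left]
    rw [← heq]
    refine lineTransform_eq_zero hqm hτ hint
      (fun m => (integral_mono (hint m) (hB m).1 (hle m)).trans (hB m).2) hμpos hμmono hμdiv hr
      (fun s hs => ?_) s hs
    rw [heq, integral_dampedRadial_mul_planeWave hn hQ hq s hu]
    refine integral_eq_zero_of_ae (Eventually.of_forall fun ω => ?_)
    refine integral_mul_damping_eq_zero hQ hε h0 _ ?_
    simpa [norm_smul] using hs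
  have hF : ∀ x, fourierHat (dampedRadial ε Q) x = 0 := by
    intro x
    rw [fourierHat_eq]
    simp_rw [fun ξ : EuclideanSpace ℝ (Fin n) => planeWave_comm ξ x]
    rcases eq_or_ne x 0 with rfl | hx
    · have := hline (EuclideanSpace.single ⟨0, hn⟩ (1 : ℝ)) (by simp) 0 le_rfl
      simpa using this
    · have hx' : ‖x‖ ≠ 0 := norm_ne_zero_iff.2 hx
      have := hline (‖x‖⁻¹ • x) (by simp [norm_smul, hx']) ‖x‖ (norm_nonneg _)
      rwa [smul_smul, mul_inv_cancel₀ hx', one_smul] at this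
  have hq0 := ae_eq_zero_of_fourierHat_eq_zero hq hF
  -- The damping can be divided out where it is positive; continuity then upgrades almost everywhere
  -- to every radius below `1 / (4ε)`.
  have hball : ∀ᵐ ξ ∂(volume.restrict (Metric.ball (0 : EuclideanSpace ℝ (Fin n)) (1 / (4 * ε)))),
      sphericalIntegral Q ‖ξ‖ = (fun _ => 0 : EuclideanSpace ℝ (Fin n) → ℂ) ξ := by
    filter_upwards [ae_restrict_of_ae hq0, ae_restrict_mem Metric.isOpen_ball.measurableSet]
      with ξ hξ hmem
    have hpos : 0 < damping ε ξ := by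
      refine lt_of_lt_of_le ?_ (le_damping hε ξ)
      rw [mem_ball_zero_iff, lt_div_iff₀ (by positivity)] at hmem
      linarith
    exact (mul_eq_zero.1 hξ).resolve_left (Complex.ofReal_ne_zero.2 hpos.ne')
  have hcont := (continuous_sphericalIntegral hQc).comp
    (continuous_norm (E := EuclideanSpace ℝ (Fin n)))
  have hEq := Measure.eqOn_open_of_ae_eq hball Metric.isOpen_ball hcont.continuousOn
    continuousOn_const
  have hmem : l • (EuclideanSpace.single ⟨0, hn⟩ (1 : ℝ) : EuclideanSpace ℝ (Fin n)) ∈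
      Metric.ball (0 : EuclideanSpace ℝ (Fin n)) (1 / (4 * ε)) := by
    rw [mem_ball_zero_iff, lt_div_iff₀ (by positivity)]
    simp only [norm_smul, PiLp.norm_single, norm_one, mul_one, Real.norm_of_nonneg hl.le]
    linarith
  have := hEq hmem
  simpa [norm_smul, abs_of_pos hl] using this

end SphericalIntegral

variable {f : EuclideanSpace ℝ (Fin n) → ℂ}

/-! ### Pairings and unique continuation for the spectral projections. -/

section SpectralProjection

/-- The normalizing constant of the spectral projections. -/
noncomputable def projConst (n : ℕ) : ℂ := (((2 * Real.pi) ^ (-(n : ℝ) / 2) : ℝ) : ℂ)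

theorem projConst_ne_zero (n : ℕ) : projConst n ≠ 0 :=
  Complex.ofReal_ne_zero.2 (Real.rpow_pos_of_pos (by positivity) _).ne'

theorem spectralProjection_eq (f : EuclideanSpace ℝ (Fin n) → ℂ) (l : ℝ)
    (x : EuclideanSpace ℝ (Fin n)) : spectralProjection f l x =
      projConst n * sphericalIntegral (fun ξ => fourierHat f ξ * planeWave x (-ξ)) l := by
  rw [spectralProjection, projConst, sphericalIntegral]
  congr 2; ext ω
  rw [planeWave, inner_neg_right, real_inner_smul_right]
  congr 2
  push_cast
  ring

theorem continuous_spectralProjection (hf : Integrable f) (l : ℝ) :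
    Continuous (spectralProjection f l) := by
  have h : spectralProjection f l = fun x =>
      projConst n * sphericalIntegral (fun ξ => fourierHat f ξ * planeWave x (-ξ)) l :=
    funext fun x => spectralProjection_eq f l x
  have hc := continuous_fourierHat hf
  have h2 := continuous_parametric_integral_of_continuous (μ := surfaceMeasure n)
    (f := fun (x : EuclideanSpace ℝ (Fin n))
      (ω : Metric.sphere (0 : EuclideanSpace ℝ (Fin n)) 1) =>
        fourierHat f (l • ω.1) * planeWave x (-(l • ω.1)))
    (by unfold Function.uncurry; fun_prop) isCompact_univ
  simp only [Measure.restrict_univ] at h2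
  rw [h]
  exact h2.const_mul _

/-- Fubini. This converts a bound for the projections on the support of `g` into a bound for
spherical integrals. -/
theorem integral_mul_spectralProjection (hf : Integrable f) {g : EuclideanSpace ℝ (Fin n) → ℂ}
    (hg : Integrable g) (l : ℝ) : ∫ x, g x * spectralProjection f l x =
      projConst n * sphericalIntegral (fun ξ => fourierHat f ξ * fourierHat g (-ξ)) l := by
  have hc := continuous_fourierHat hf
  have h1 : ∀ x, g x * spectralProjection f l x = projConst n *
      ∫ ω : Metric.sphere (0 : EuclideanSpace ℝ (Fin n)) 1,
        g x * fourierHat f (l • ω.1) * planeWave x (-(l • ω.1)) ∂(surfaceMeasure n) := by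
    intro x
    rw [spectralProjection_eq, sphericalIntegral, mul_left_comm, ← integral_const_mul]
    simp_rw [mul_assoc]
  simp_rw [h1]
  rw [integral_const_mul, integral_integral_swap, sphericalIntegral]
  · congr 2; ext ω
    simp_rw [fourierHat_eq g, mul_assoc, mul_left_comm (g _)]
    rw [integral_const_mul]
  · refine integrable_mul_planeWave (u := fun p : EuclideanSpace ℝ (Fin n) ×
      Metric.sphere (0 : EuclideanSpace ℝ (Fin n)) 1 => p.1) (v := fun p => -(l • p.2.1)) ?_
      (Continuous.aestronglyMeasurable (by fun_prop))
    refine hg.mul_prod (g := fun ω : Metric.sphere (0 : EuclideanSpace ℝ (Fin n)) 1 =>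
      fourierHat f (l • ω.1)) ?_
    exact Integrable.of_bound (Continuous.aestronglyMeasurable (by fun_prop)) (∫ y, ‖f y‖)
      (Eventually.of_forall fun ω => norm_fourierHat_le f _)

/-- Unique continuation for the spectral projections. -/
theorem spectralProjection_eq_zero_of_isOpen (hf : Integrable f) (l : ℝ)
    {U : Set (EuclideanSpace ℝ (Fin n))} (hU : IsOpen U) (hUne : U.Nonempty)
    (h0 : ∀ x ∈ U, spectralProjection f l x = 0) (x : EuclideanSpace ℝ (Fin n)) :
    spectralProjection f l x = 0 := by
  obtain ⟨x₀, hx₀⟩ := hUne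
  have hc := continuous_fourierHat hf
  set v := x - x₀ with hv
  set g : Metric.sphere (0 : EuclideanSpace ℝ (Fin n)) 1 → ℂ :=
    fun ω => fourierHat f (l • ω.1) * planeWave x₀ (-(l • ω.1)) with hg
  set τ : Metric.sphere (0 : EuclideanSpace ℝ (Fin n)) 1 → ℝ :=
    fun ω => inner ℝ v (-(l • ω.1)) with hτ
  have hgc : Continuous g := by fun_prop
  have hτc : Continuous τ := by fun_prop
  have heq : ∀ s : ℝ, spectralProjection f l (x₀ + s • v) =
      projConst n * lineTransform (surfaceMeasure n) g τ 0 s := by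
    intro s
    rw [spectralProjection_eq, sphericalIntegral, lineTransform]
    congr 2; ext ω
    rw [planeWave_add, pow_zero, mul_one, ← mul_assoc]
    simp only [hg, hτ]
    congr 1
    rw [planeWave, real_inner_smul_left]
  set M : ℝ := ‖v‖ * |l| + 1 with hM
  have hM0 : 0 < M := by positivity
  have hτM : ∀ ω, |τ ω| ≤ M := by
    intro ω
    have := abs_real_inner_le_norm v (-(l • ω.1))
    rw [norm_neg, norm_smul, norm_eq_of_mem_sphere, mul_one, Real.norm_eq_abs] at this
    simp only [hτ]
    linarith
  have hgi : Integrable g (surfaceMeasure n) :=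
    Integrable.of_bound hgc.aestronglyMeasurable (∫ y, ‖f y‖) (Eventually.of_forall fun ω => by
      rw [hg, norm_mul, norm_planeWave, mul_one]
      exact norm_fourierHat_le f _)
  have hle : ∀ (m : ℕ) ω, ‖g ω‖ * |τ ω| ^ m ≤ ‖g ω‖ * M ^ m := fun m ω => by
    have := hτM ω
    gcongr
  have hint : ∀ m : ℕ, Integrable (fun ω => ‖g ω‖ * |τ ω| ^ m) (surfaceMeasure n) := fun m =>
    (hgi.norm.mul_const (M ^ m)).mono' (Continuous.aestronglyMeasurable (by fun_prop))
      (Eventually.of_forall fun ω => by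
        rw [Real.norm_of_nonneg (by positivity)]
        exact hle m ω)
  obtain ⟨δ, hδ, hball⟩ : ∃ δ > 0, ∀ s : ℝ, |s| < δ → x₀ + s • v ∈ U := by
    have hcont : Continuous fun s : ℝ => x₀ + s • v := by fun_prop
    have := (hU.preimage hcont).mem_nhds (x := 0) (by simpa using hx₀)
    obtain ⟨δ, hδ, h⟩ := Metric.mem_nhds_iff.1 this
    exact ⟨δ, hδ, fun s hs => h (by simpa using hs)⟩
  -- The frequencies are bounded by `M`, so constant ratios suffice: this is the analytic case of
  -- Denjoy–Carleman, on the line from `x₀` to `x`.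
  have hz := lineTransform_eq_zero (μ := fun _ => M) (C := ∫ ω, ‖g ω‖ ∂(surfaceMeasure n))
    hgc.aestronglyMeasurable hτc.aestronglyMeasurable hint
    (fun m => by
      rw [prod_const, card_range, ← integral_mul_const]
      exact integral_mono (hint m) (hgi.norm.mul_const _) (hle m))
    (fun _ => hM0) monotone_const (by rw [summable_const_iff]; positivity)
    hδ (fun s hs => by
      have := heq s
      rw [h0 _ (hball s hs)] at this
      exact (mul_eq_zero.1 this.symm).resolve_left (projConst_ne_zero n)) 1 zero_le_one
  have := heq 1
  rw [hz, mul_zero, one_smul, hv, add_sub_cancel] at this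
  exact this

end SpectralProjection

/-! ### The uniqueness theorems. -/

section Uniqueness

variable {θ : ℝ → ℝ} {V : Set (EuclideanSpace ℝ (Fin n))}

theorem continuous_fourierHat_mul (hf : Integrable f) (φ : 𝓢(EuclideanSpace ℝ (Fin n), ℂ)) :
    Continuous fun ξ => fourierHat f ξ * fourierHat φ (-ξ) := by
  have h1 := continuous_fourierHat hf
  have h2 := continuous_fourierHat φ.integrable
  fun_prop

theorem integrable_fourierHat_mul (hf : Integrable f) (φ : 𝓢(EuclideanSpace ℝ (Fin n), ℂ)) :
    Integrable fun ξ => fourierHat f ξ * fourierHat φ (-ξ) :=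
  (integrable_fourierHat_neg φ).bdd_mul (c := ∫ y, ‖f y‖)
    (continuous_fourierHat hf).aestronglyMeasurable
    (Eventually.of_forall fun ξ => norm_fourierHat_le f ξ)

theorem ae_eq_zero_of_decay (hn : 1 ≤ n) (hθpos : ∀ t : ℝ, 0 ≤ t → 0 < θ t)
    (hθanti : AntitoneOn θ (Set.Ici 0))
    (hθint : ∫⁻ t in Set.Ioi (1 : ℝ), ENNReal.ofReal (θ t / t) = ⊤)
    (hf : Integrable f) (hVopen : IsOpen V) (hVne : V.Nonempty)
    (hfV : ∀ᵐ x ∂(volume.restrict V), f x = 0) {C : ℝ}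
    (hC : ∀ l : ℝ, 0 < l → ∀ x ∈ V, ‖spectralProjection f l x‖ ≤ C * Real.exp (-(l * θ l))) :
    f =ᵐ[volume] 0 := by
  obtain ⟨c, hc0, hc⟩ := exists_fourier_inversion n
  obtain ⟨x₀, hx₀⟩ := hVne
  obtain ⟨ρ, hρ, hball⟩ := Metric.isOpen_iff.1 hVopen x₀ hx₀
  have hfV' : ∀ᵐ x, x ∈ V → f x = 0 := (ae_restrict_iff' hVopen.measurableSet).1 hfV
  have hU : ∀ l : ℝ, 0 < l → ∀ x ∈ Metric.ball x₀ (ρ / 2), spectralProjection f l x = 0 := by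
    intro l hl
    have hcont := continuous_spectralProjection hf l
    have hae : ∀ᵐ x, x ∈ Metric.ball x₀ (ρ / 2) → spectralProjection f l x = 0 := by
      refine Metric.isOpen_ball.ae_eq_zero_of_integral_contDiff_smul_eq_zero
        (hcont.locallyIntegrable.locallyIntegrableOn _) fun g hg hgs hgU => ?_
      obtain ⟨φ, hφ⟩ := exists_schwartzMap_eq hg hgs
      have hsupp : ∀ x, x ∉ Metric.ball x₀ (ρ / 2) → φ x = 0 := fun x hx => by
        rw [hφ, image_eq_zero_of_notMem_tsupport fun h => hx (hgU h), Complex.ofReal_zero]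
      have hpair := fun l => integral_mul_spectralProjection hf φ.integrable l
      -- The bound `ρ / 16` makes `r + 4ε ≤ ρ / 2` for `r = ρ / 4`, so translates of the support of
      -- `φ` stay in `V`. The bound `1 / (8 l)` puts radius `l` where the damping is positive.
      have hε : 0 < min (ρ / 16) (1 / (8 * l)) := by positivity
      have hz := sphericalIntegral_eq_zero hn hθpos hθanti hθint (continuous_fourierHat_mul hf φ)
        (integrable_fourierHat_mul hf φ) (r := ρ / 4) (ε := min (ρ / 16) (1 / (8 * l)))
        (C := ‖projConst n‖⁻¹ * ((∫ x, ‖φ x‖) * C)) (by positivity) hε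
        (fun y hy => ?_) (fun t ht => ?_) hl ?_
      · have := hpair l
        rw [hz, mul_zero] at this
        rw [← this]
        congr 1; ext x
        rw [hφ, Complex.real_smul]
      · rw [integral_fourierHat_mul hf φ (hc φ)]
        refine mul_eq_zero_of_right _ (integral_eq_zero_of_ae ?_)
        filter_upwards [hfV'] with z hz
        by_cases hzV : z ∈ V
        · simp [hz hzV]
        · have : φ (z + y) = 0 := by
            refine hsupp _ fun h => hzV (hball ?_)
            have h16 := min_le_left (ρ / 16) (1 / (8 * l))
            rw [mem_ball_iff_norm] at h ⊢
            have h3 : ‖z - x₀‖ ≤ ‖z + y - x₀‖ + ‖y‖ := by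
              have := norm_sub_le (z + y - x₀) y
              rwa [show z + y - x₀ - y = z - x₀ by abel] at this
            linarith
          simp [this]
      · have h1 : ‖∫ x, φ x * spectralProjection f t x‖ ≤
            (∫ x, ‖φ x‖) * C * Real.exp (-(t * θ t)) := by
          rw [mul_assoc, ← integral_mul_const]
          refine norm_integral_le_of_norm_le (φ.integrable.norm.mul_const _)
            (Eventually.of_forall fun x => ?_)
          rw [norm_mul]
          by_cases hx : x ∈ Metric.ball x₀ (ρ / 2)
          · have := hC t ht x (hball (Metric.ball_subset_ball (by linarith) hx))
            gcongr
          · simp [hsupp x hx]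
        rw [hpair t, norm_mul] at h1
        have h2 : 0 < ‖projConst n‖ := norm_pos_iff.2 (projConst_ne_zero n)
        rw [mul_assoc, inv_mul_eq_div, le_div_iff₀' h2]
        exact h1
      · have h8 := min_le_right (ρ / 16) (1 / (8 * l))
        calc 4 * min (ρ / 16) (1 / (8 * l)) * l ≤ 4 * (1 / (8 * l)) * l := by gcongr
          _ = 1 / 2 := by field_simp; norm_num
          _ < 1 := by norm_num
    have hae' : spectralProjection f l =ᵐ[volume.restrict (Metric.ball x₀ (ρ / 2))] fun _ => 0 :=
      (ae_restrict_iff' Metric.isOpen_ball.measurableSet).2 hae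
    exact Measure.eqOn_open_of_ae_eq hae' Metric.isOpen_ball hcont.continuousOn continuousOn_const
  have hall : ∀ l : ℝ, 0 < l → ∀ x, spectralProjection f l x = 0 := fun l hl =>
    spectralProjection_eq_zero_of_isOpen hf l Metric.isOpen_ball
      ⟨x₀, Metric.mem_ball_self (by positivity)⟩ (hU l hl)
  refine ae_eq_zero_of_integral_mul_schwartzMap hf fun φ => ?_
  have hQ0 := integral_eq_zero_of_sphericalIntegral hn (integrable_fourierHat_mul hf φ)
    fun l hl => by
      have := integral_mul_spectralProjection hf φ.integrable l
      simpa [hall l hl, projConst_ne_zero n] using this.symm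
  have := integral_fourierHat_mul hf φ (hc φ) 0
  have h0 : ∀ ξ : EuclideanSpace ℝ (Fin n), planeWave 0 ξ = 1 := fun ξ => by
    rw [planeWave_comm, planeWave_zero]
  simp only [h0, mul_one, add_zero, hQ0] at this
  exact (mul_eq_zero.1 this.symm).resolve_left hc0

theorem fourierHat_conj_neg (f : EuclideanSpace ℝ (Fin n) → ℂ) (ξ : EuclideanSpace ℝ (Fin n)) :
    fourierHat (fun x => starRingEnd ℂ (f x)) (-ξ) = starRingEnd ℂ (fourierHat f ξ) := by
  rw [fourierHat_eq, fourierHat_eq, ← integral_conj]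
  simp_rw [planeWave_neg_right, map_mul]

/-- Decay of the spectral projections on the support of `f` propagates to the whole space. -/
theorem norm_spectralProjection_le_of_compl (hf : Integrable f)
    (hfV : ∀ᵐ x, x ∈ V → f x = 0) {D l : ℝ}
    (hD : ∀ x ∈ Vᶜ, ‖spectralProjection f l x‖ ≤ D ^ 2) (hD0 : 0 < D)
    (x : EuclideanSpace ℝ (Fin n)) :
    ‖spectralProjection f l x‖ ≤ ‖projConst n‖ *
      ((surfaceMeasure n).real Set.univ + ‖projConst n‖⁻¹ * ∫ y, ‖f y‖) * D := by
  have hc := continuous_fourierHat hf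
  have hk : 0 < ‖projConst n‖ := norm_pos_iff.2 (projConst_ne_zero n)
  have hb := norm_fourierHat_le f
  have hconj : Integrable fun x => starRingEnd ℂ (f x) :=
    (Complex.conjLIE.toContinuousLinearEquiv.toContinuousLinearMap.integrable_comp hf)
  have hsq : sphericalIntegral (fun ξ => fourierHat f ξ *
      fourierHat (fun x => starRingEnd ℂ (f x)) (-ξ)) l =
      ((∫ ω : Metric.sphere (0 : EuclideanSpace ℝ (Fin n)) 1,
        ‖fourierHat f (l • ω.1)‖ ^ 2 ∂(surfaceMeasure n) : ℝ) : ℂ) := by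
    rw [sphericalIntegral, ← integral_complex_ofReal]
    congr 1; ext ω
    rw [fourierHat_conj_neg, Complex.mul_conj, Complex.normSq_eq_norm_sq]
  have hL2 : ∫ ω : Metric.sphere (0 : EuclideanSpace ℝ (Fin n)) 1,
      ‖fourierHat f (l • ω.1)‖ ^ 2 ∂(surfaceMeasure n) ≤
      ‖projConst n‖⁻¹ * ((∫ y, ‖f y‖) * D ^ 2) := by
    -- Since `f` vanishes on `V`, this pairing sees the projection only on `Vᶜ`; it equals, up to a
    -- constant, the squared L² norm of `fourierHat f` on the sphere.
    have h1 : ‖∫ x, starRingEnd ℂ (f x) * spectralProjection f l x‖ ≤ (∫ y, ‖f y‖) * D ^ 2 := by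
      rw [← integral_mul_const]
      refine norm_integral_le_of_norm_le (hf.norm.mul_const _) ?_
      filter_upwards [hfV] with y hy
      rw [norm_mul, RCLike.norm_conj]
      by_cases hyV : y ∈ V
      · simp [hy hyV]
      · have := hD y hyV
        gcongr
    rw [integral_mul_spectralProjection hf hconj, hsq, norm_mul, Complex.norm_real,
      Real.norm_of_nonneg (integral_nonneg fun _ => by positivity)] at h1
    rw [inv_mul_eq_div, le_div_iff₀' hk]
    exact h1
  have hi2 : Integrable (fun ω : Metric.sphere (0 : EuclideanSpace ℝ (Fin n)) 1 =>
      ‖fourierHat f (l • ω.1)‖ ^ 2) (surfaceMeasure n) :=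
    Integrable.of_bound (Continuous.aestronglyMeasurable (by fun_prop)) ((∫ y, ‖f y‖) ^ 2)
      (Eventually.of_forall fun ω => by
        rw [Real.norm_of_nonneg (by positivity)]
        exact pow_le_pow_left₀ (norm_nonneg _) (hb _) 2)
  -- From L² to L¹ by `2a ≤ D + a² / D`, balanced so that both terms are of order `D`.
  have hL1 : ‖sphericalIntegral (fun ξ => fourierHat f ξ * planeWave x (-ξ)) l‖ ≤
      ∫ ω : Metric.sphere (0 : EuclideanSpace ℝ (Fin n)) 1,
        (D + D⁻¹ * ‖fourierHat f (l • ω.1)‖ ^ 2) ∂(surfaceMeasure n) := by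
    refine norm_integral_le_of_norm_le ((integrable_const D).add (hi2.const_mul D⁻¹))
      (Eventually.of_forall fun ω => ?_)
    rw [norm_mul, norm_planeWave, mul_one]
    have h1 : D⁻¹ * ‖fourierHat f (l • ω.1)‖ ^ 2 + D - 2 * ‖fourierHat f (l • ω.1)‖ =
        D⁻¹ * (‖fourierHat f (l • ω.1)‖ - D) ^ 2 := by
      field_simp
      ring
    have h2 : 0 ≤ D⁻¹ * (‖fourierHat f (l • ω.1)‖ - D) ^ 2 := by positivity
    have h3 := norm_nonneg (fourierHat f (l • ω.1))
    linarith
  rw [integral_add (integrable_const D) (hi2.const_mul D⁻¹), integral_const_mul, integral_const,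
    smul_eq_mul] at hL1
  rw [spectralProjection_eq, norm_mul, mul_assoc]
  refine mul_le_mul_of_nonneg_left (hL1.trans ?_) hk.le
  have h4 := mul_le_mul_of_nonneg_left hL2 (inv_nonneg.2 hD0.le)
  have h5 : D⁻¹ * (‖projConst n‖⁻¹ * ((∫ y, ‖f y‖) * D ^ 2)) =
      ‖projConst n‖⁻¹ * (∫ y, ‖f y‖) * D := by field_simp
  rw [h5] at h4
  linarith

theorem lintegral_half_eq_top
    (hθint : ∫⁻ t in Set.Ioi (1 : ℝ), ENNReal.ofReal (θ t / t) = ⊤) :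
    ∫⁻ t in Set.Ioi (1 : ℝ), ENNReal.ofReal (θ t / 2 / t) = ⊤ := by
  have h : ∀ t, ENNReal.ofReal (θ t / 2 / t) =
      ENNReal.ofReal (1 / 2) * ENNReal.ofReal (θ t / t) := fun t => by
    rw [← ENNReal.ofReal_mul (by norm_num)]
    congr 1; ring
  simp_rw [h]
  rw [lintegral_const_mul' _ _ ENNReal.ofReal_ne_top, hθint]
  exact ENNReal.mul_top (by simp)

/-- The passage to all of space takes a square root of the bound, so `ae_eq_zero_of_decay` is
applied with `θ / 2`, whose logarithmic integral still diverges. -/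
theorem ae_eq_zero_of_decay_compl (hn : 1 ≤ n) (hθpos : ∀ t : ℝ, 0 ≤ t → 0 < θ t)
    (hθanti : AntitoneOn θ (Set.Ici 0))
    (hθint : ∫⁻ t in Set.Ioi (1 : ℝ), ENNReal.ofReal (θ t / t) = ⊤)
    (hf : Integrable f) (hVopen : IsOpen V) (hVne : V.Nonempty)
    (hfV : ∀ᵐ x ∂(volume.restrict V), f x = 0) {C : ℝ}
    (hC : ∀ l : ℝ, 0 < l → ∀ x ∈ Vᶜ, ‖spectralProjection f l x‖ ≤ C * Real.exp (-(l * θ l))) :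
    f =ᵐ[volume] 0 := by
  have hfV' : ∀ᵐ x, x ∈ V → f x = 0 := (ae_restrict_iff' hVopen.measurableSet).1 hfV
  -- Adding `1` keeps `S` positive, because `D` is divided by.
  set S := √(|C| + 1) with hS
  have hS0 : 0 < S := Real.sqrt_pos.2 (by positivity)
  have hS2 : S ^ 2 = |C| + 1 := Real.sq_sqrt (by positivity)
  refine ae_eq_zero_of_decay (θ := fun t => θ t / 2)
    (C := ‖projConst n‖ *
      ((surfaceMeasure n).real Set.univ + ‖projConst n‖⁻¹ * ∫ y, ‖f y‖) * S) hn
    (fun t ht => half_pos (hθpos t ht))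
    (fun s hs t ht hst => by
      have := hθanti hs ht hst
      beta_reduce
      linarith)
    (lintegral_half_eq_top hθint) hf hVopen hVne hfV fun l hl x _ => ?_
  rw [mul_assoc]
  refine norm_spectralProjection_le_of_compl hf hfV' (fun y hy => ?_) (by positivity) x
  have h1 : (S * Real.exp (-(l * (θ l / 2)))) ^ 2 = (|C| + 1) * Real.exp (-(l * θ l)) := by
    rw [mul_pow, hS2, ← Real.exp_nat_mul]
    congr 2
    push_cast
    ring
  rw [h1]
  refine (hC l hl y hy).trans ?_
  have := le_abs_self C
  gcongr
  linarith

end Uniqueness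

end EuclideanProjection

theorem mainTheorem11 (n : ℕ) (hn : 1 ≤ n) (θ : ℝ → ℝ)
    (hθpos : ∀ t : ℝ, 0 ≤ t → 0 < θ t)
    (hθanti : AntitoneOn θ (Set.Ici 0))
    (hθlim : Filter.Tendsto θ Filter.atTop (nhds 0))
    (hθint : ∫⁻ t in Set.Ioi (1 : ℝ), ENNReal.ofReal (θ t / t) = ⊤)
    (f : EuclideanSpace ℝ (Fin n) → ℂ)
    (hf : MeasureTheory.Integrable f MeasureTheory.volume)
    (hf0 : ¬ f =ᵐ[MeasureTheory.volume] 0)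
    (V : Set (EuclideanSpace ℝ (Fin n))) (hVopen : IsOpen V) (hVne : V.Nonempty)
    (hfV : ∀ᵐ x ∂(MeasureTheory.volume.restrict V), f x = 0) :
    (¬ ∃ C : ℝ, ∀ l : ℝ, 0 < l → ∀ x ∈ V,
        ‖EuclideanProjection.spectralProjection f l x‖ ≤ C * Real.exp (-(l * θ l))) ∧
    ((0 : EuclideanSpace ℝ (Fin n)) ∈ V →
      ¬ ∃ C : ℝ, ∀ l : ℝ, 0 < l → ∀ x ∈ Vᶜ,
        ‖EuclideanProjection.spectralProjection f l x‖ ≤ C * Real.exp (-(l * θ l))) :=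
  ⟨fun ⟨_, hC⟩ => hf0 (EuclideanProjection.ae_eq_zero_of_decay hn hθpos hθanti hθint hf hVopen
      hVne hfV hC),
    fun _ ⟨_, hC⟩ => hf0 (EuclideanProjection.ae_eq_zero_of_decay_compl hn hθpos hθanti hθint hf
      hVopen hVne hfV hC)⟩
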